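/- Let $d_{\mathrm{av}}\in\mathbb R$, $\alpha\ge 2$ and $\varphi\in H^1(\mathbb R)$ (complex-valued). Let $d_0:\mathbb R\to\mathbb R$ be the $2$-periodic function with $d_0=1$ on $[0,1)$ and $d_0=-1$ on $[1,2)$, put $D(t)=\int_0^t d_0(s)\,ds$, and let $T_t=e^{it\partial_x^2}$ be the solution operator of the free Schrödinger equation $i\partial_t w+\partial_x^2 w=0$ on $\mathbb R$. For $\varepsilon>0$ consider the dispersion managed equation $$i\partial_t u+\Bigl(d_{\mathrm{av}}+\tfrac1\varepsilon d_0\bigl(\tfrac t\varepsilon\bigr)\Bigr)\partial_x^2u+|u|^\alpha u=0,\qquad u(0)=\varphi, \tag{1}$$ and the averaged equation $$i\partial_t v+d_{\mathrm{av}}\,\partial_x^2v+\int_0^1T_r^{-1}\bigl(|T_rv|^\alpha T_rv\bigr)\,dr=0,\qquad v(0)=\varphi. \tag{2}$$ Solutions on an interval $J\ni 0$ are functions in $\mathcal C(J,H^1(\mathbb R))$ satisfying the corresponding Duhamel formula on $J$; for an equation $i\partial_tu+d(t)\partial_x^2u+N(u)=0$ this reads $u(t)=T_{\int_0^td}\,\varphi+i\int_0^tT_{\int_s^td}\,N(u(s))\,ds$.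 A maximal solution is a solution on an open interval $(-S,S')$, $0<S,S'\le\infty$, that has no extension to a solution on a strictly larger open interval. Equation (2) has a unique maximal solution $v$, and for every $\varepsilon>0$ equation (1) has a unique maximal solution $u_\varepsilon$. Let $(-T_-,T_+)$ be the interval of existence of $v$. Then, for every $0<M<\min\{T_-,T_+\}$, the solution $u_\varepsilon$ exists on $[-M,M]$ for all sufficiently small $\varepsilon>0$, and $$\lim_{\varepsilon\to0}\bigl\|u_\varepsilon-T_{D(t/\varepsilon)}v\bigr\|_{L^\infty([-M,M],H^1(\mathbb R))}=0 .$$ -/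

import Mathlib

open MeasureTheory SchwartzMap Filter Topology Set
open scoped FourierTransform LineDeriv ENNReal

noncomputable section

namespace DMNLS

/-! ### The spaces `L²(ℝ)` and `H¹(ℝ)` -/

/-- `L²(ℝ; ℂ)`. -/
abbrev L2 : Type := Lp (α := ℝ) ℂ 2 volume

/-- `g` is the derivative of `f` in the sense of (tempered) distributions. -/
def IsWeakDeriv (f g : L2) : Prop :=
  ∂_{(1 : ℝ)} (f : 𝓢'(ℝ, ℂ)) = (g : 𝓢'(ℝ, ℂ))

theorem toTemperedDistribution_injective {f g : L2}
    (h : (f : 𝓢'(ℝ, ℂ)) = (g : 𝓢'(ℝ, ℂ))) : f = g := by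
  have hk := Lp.ker_toTemperedDistributionCLM_eq_bot (E := ℝ) (F := ℂ) (μ := volume) (p := 2)
  exact LinearMap.ker_eq_bot.mp hk h

/-- The space of pairs `(f, g)` of elements of `L²(ℝ)` such that `g` is the weak derivative of `f`,
with the norm `(‖f‖² + ‖g‖²)^(1/2)`. -/
def sobolevH1 : Submodule ℂ (WithLp 2 (L2 × L2)) where
  carrier := {p | IsWeakDeriv p.fst p.snd}
  zero_mem' := by
    have h : ((0 : L2) : 𝓢'(ℝ, ℂ)) = 0 := (Lp.toTemperedDistributionCLM ℂ volume 2).map_zero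
    simp [IsWeakDeriv, h]
  add_mem' := by
    intro p q hp hq
    have h : ∀ a b : L2, ((a + b : L2) : 𝓢'(ℝ, ℂ)) = (a : 𝓢'(ℝ, ℂ)) + (b : 𝓢'(ℝ, ℂ)) :=
      fun a b => (Lp.toTemperedDistributionCLM ℂ volume 2).map_add a b
    simp only [IsWeakDeriv, Set.mem_ofPred_eq, WithLp.add_fst, WithLp.add_snd, h] at *
    rw [LineDeriv.lineDerivOp_add, hp, hq]
  smul_mem' := by
    intro c p hp
    have h : ∀ a : L2, ((c • a : L2) : 𝓢'(ℝ, ℂ)) = c • (a : 𝓢'(ℝ, ℂ)) :=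
      fun a => (Lp.toTemperedDistributionCLM ℂ volume 2).map_smul c a
    simp only [IsWeakDeriv, Set.mem_ofPred_eq, WithLp.smul_fst, WithLp.smul_snd, h] at *
    rw [LineDeriv.lineDerivOp_smul, hp]

/-- The Sobolev space `H¹(ℝ)`, with `‖f‖² = ‖f‖²_{L²} + ‖f'‖²_{L²}`. -/
abbrev H1 : Type := sobolevH1

/-- The underlying `L²` function of an element of `H¹(ℝ)`. -/
def H1.toL2 (f : H1) : L2 := (f : WithLp 2 (L2 × L2)).fst

/-- The weak derivative of an element of `H¹(ℝ)`. -/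
def H1.deriv (f : H1) : L2 := (f : WithLp 2 (L2 × L2)).snd

theorem H1.isWeakDeriv (f : H1) : IsWeakDeriv f.toL2 f.deriv := f.2

/-- Weak differentiation is multiplication by `2πiξ` on the Fourier side. -/
theorem isWeakDeriv_iff (f g : L2) :
    IsWeakDeriv f g ↔
      (𝓕 g : L2) =ᵐ[volume] fun ξ : ℝ => (2 * Real.pi * Complex.I * ξ) * (𝓕 f : L2) ξ := by
  have htg : (fun ξ : ℝ => (ξ : ℂ)).HasTemperateGrowth := by fun_prop
  have hin : (fun x : ℝ => ((inner ℝ x (1 : ℝ) : ℝ) : ℂ)) = fun x : ℝ => (x : ℂ) := by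
    ext x; simp
  have hL : ∀ φ : 𝓢(ℝ, ℂ), (𝓕 (∂_{(1 : ℝ)} (f : 𝓢'(ℝ, ℂ)))) φ
      = ∫ ξ, φ ξ * (2 * Real.pi * Complex.I * ξ * (𝓕 f : L2) ξ) := by
    intro φ
    rw [TemperedDistribution.fourier_lineDerivOp_eq, Lp.fourier_toTemperedDistribution_eq, hin]
    change (2 * Real.pi * Complex.I) • ((𝓕 f : L2) : 𝓢'(ℝ, ℂ)) _ = _
    rw [Lp.toTemperedDistribution_apply, smul_eq_mul, ← integral_const_mul]
    congr 1
    ext ξ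
    have h : (SchwartzMap.smulLeftCLM ℂ (fun x : ℝ => (x : ℂ)) φ) ξ = (ξ : ℂ) • φ ξ :=
      SchwartzMap.smulLeftCLM_apply_apply htg φ ξ
    erw [h]
    simp only [smul_eq_mul]
    ring
  have hR : ∀ φ : 𝓢(ℝ, ℂ), (𝓕 (g : 𝓢'(ℝ, ℂ))) φ = ∫ ξ, φ ξ * (𝓕 g : L2) ξ := by
    intro φ
    rw [Lp.fourier_toTemperedDistribution_eq, Lp.toTemperedDistribution_apply]
    rfl
  have h1 : IsWeakDeriv f g ↔ 𝓕 (∂_{(1 : ℝ)} (f : 𝓢'(ℝ, ℂ))) = 𝓕 (g : 𝓢'(ℝ, ℂ)) := by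
    constructor
    · intro h; rw [h]
    · intro h
      have := congrArg (fun u : 𝓢'(ℝ, ℂ) => (𝓕⁻ u : 𝓢'(ℝ, ℂ))) h
      simpa [IsWeakDeriv] using this
  rw [h1]
  constructor
  · intro h
    have hlf : LocallyIntegrable (fun ξ : ℝ => (𝓕 f : L2) ξ) volume :=
      (Lp.memLp (𝓕 f : L2)).locallyIntegrable (by norm_num)
    refine ae_eq_of_integral_contDiff_smul_eq
      ((Lp.memLp (𝓕 g : L2)).locallyIntegrable (by norm_num)) ?_ ?_
    · rw [← locallyIntegrableOn_univ] at hlf ⊢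
      exact hlf.continuousOn_mul (by fun_prop) isOpen_univ.isLocallyClosed
    · intro w hw hc
      have hg₁ : HasCompactSupport (Complex.ofRealCLM ∘ w) := hc.comp_left rfl
      have hg₂ : ContDiff ℝ (⊤ : ℕ∞) (Complex.ofRealCLM ∘ w) := by fun_prop
      have h2 := congrArg (fun u : 𝓢'(ℝ, ℂ) => u (hg₁.toSchwartzMap hg₂)) h
      simp only [hL, hR] at h2
      simpa using h2.symm
  · intro h
    ext φ
    rw [hL, hR]
    refine integral_congr_ae ?_
    filter_upwards [h] with ξ hξ
    rw [hξ]

/-- Elements of `H¹(ℝ)` are essentially bounded. -/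
theorem H1.memLp_top (f : H1) : MemLp f.toL2 ∞ volume := by
  have hw := (isWeakDeriv_iff _ _).mp f.isWeakDeriv
  set F : L2 := 𝓕 f.toL2 with hF
  set G : L2 := 𝓕 f.deriv with hG
  have hint : Integrable F volume := by
    have hb : MemLp (fun ξ : ℝ => (1 + ‖ξ‖ ^ 2) ^ (-(1 / 2) : ℝ)) 2 volume := by
      rw [memLp_two_iff_integrable_sq]
      · have := integrable_rpow_neg_one_add_norm_sq (E := ℝ) (μ := volume) (r := 2) (by simp)
        refine this.congr (Eventually.of_forall fun ξ => ?_)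
        simp only
        have h0 : (0 : ℝ) ≤ 1 + ‖ξ‖ ^ 2 := by positivity
        rw [← Real.rpow_mul_natCast h0]
        norm_num
      · refine Continuous.aestronglyMeasurable ?_
        refine Continuous.rpow_const (by fun_prop) fun ξ => Or.inl (by positivity)
    have hs : MemLp (fun ξ : ℝ => ‖F ξ‖ + ‖G ξ‖) 2 volume :=
      (Lp.memLp F).norm.add (Lp.memLp G).norm
    have hp : Integrable (fun ξ : ℝ => (1 + ‖ξ‖ ^ 2) ^ (-(1 / 2) : ℝ) * (‖F ξ‖ + ‖G ξ‖)) volume :=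
      hb.integrable_mul hs
    refine hp.mono' (Lp.aestronglyMeasurable F) ?_
    filter_upwards [hw] with ξ hξ
    rw [hξ, Real.rpow_neg (by positivity), inv_mul_eq_div, le_div_iff₀ (by positivity),
      ← Real.sqrt_eq_rpow]
    have h1 : Real.sqrt (1 + ‖ξ‖ ^ 2) ≤ 1 + ‖ξ‖ := by
      rw [Real.sqrt_le_left (by positivity)]
      nlinarith [norm_nonneg ξ]
    have h2 : ‖(2 * Real.pi * Complex.I * ξ) * F ξ‖ = 2 * Real.pi * ‖ξ‖ * ‖F ξ‖ := by
      simp [abs_of_pos Real.pi_pos]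
    rw [h2]
    have h3 : (1 : ℝ) ≤ 2 * Real.pi := by nlinarith [Real.pi_gt_three]
    calc ‖F ξ‖ * Real.sqrt (1 + ‖ξ‖ ^ 2) ≤ ‖F ξ‖ * (1 + ‖ξ‖) := by gcongr
      _ = ‖F ξ‖ + 1 * ‖ξ‖ * ‖F ξ‖ := by ring
      _ ≤ ‖F ξ‖ + 2 * Real.pi * ‖ξ‖ * ‖F ξ‖ := by gcongr
  have hcont : Continuous (𝓕⁻ (F : ℝ → ℂ) : ℝ → ℂ) := by
    have hL : Continuous fun p : ℝ × ℝ => (-innerₗ ℝ) p.1 p.2 := continuous_inner.neg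
    exact VectorFourier.fourierIntegral_continuous Real.continuous_fourierChar hL hint
  have heq : (f.toL2 : ℝ → ℂ) =ᵐ[volume] (𝓕⁻ (F : ℝ → ℂ) : ℝ → ℂ) := by
    refine ae_eq_of_integral_contDiff_smul_eq
      ((Lp.memLp f.toL2).locallyIntegrable (by norm_num)) hcont.locallyIntegrable ?_
    intro w hw hc
    have hg₁ : HasCompactSupport (Complex.ofRealCLM ∘ w) := hc.comp_left rfl
    have hg₂ : ContDiff ℝ (⊤ : ℕ∞) (Complex.ofRealCLM ∘ w) := by fun_prop
    set φ : 𝓢(ℝ, ℂ) := hg₁.toSchwartzMap hg₂ with hφ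
    have e1 : ((f.toL2 : L2) : 𝓢'(ℝ, ℂ)) = (𝓕⁻ (F : 𝓢'(ℝ, ℂ)) : 𝓢'(ℝ, ℂ)) := by
      rw [Lp.fourierInv_toTemperedDistribution_eq, hF]
      congr 1
      exact ((Lp.fourierTransformₗᵢ ℝ ℂ).symm_apply_apply f.toL2).symm
    have e2 := congrArg (fun u : 𝓢'(ℝ, ℂ) => u φ) e1
    simp only [TemperedDistribution.fourierInv_apply, Lp.toTemperedDistribution_apply] at e2
    have hL : Continuous fun p : ℝ × ℝ => (-innerₗ ℝ) p.1 p.2 := continuous_inner.neg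
    have e3 : ∫ x, (𝓕⁻ (F : ℝ → ℂ) : ℝ → ℂ) x • φ x
        = ∫ ξ, F ξ • (𝓕⁻ (φ : ℝ → ℂ) : ℝ → ℂ) ξ := by
      have := VectorFourier.integral_fourierIntegral_smul_eq_flip (L := -innerₗ ℝ)
        Real.continuous_fourierChar hL hint (φ.integrable (μ := volume))
      rwa [show (-innerₗ ℝ : ℝ →ₗ[ℝ] ℝ →ₗ[ℝ] ℝ).flip = -innerₗ ℝ by
        ext; simp] at this
    have e4 : ((𝓕⁻ φ : 𝓢(ℝ, ℂ)) : ℝ → ℂ) = 𝓕⁻ (φ : ℝ → ℂ) := SchwartzMap.fourierInv_coe φ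
    rw [← e4] at e3
    have e5 : ∀ x, φ x = (w x : ℂ) := fun x => rfl
    calc ∫ x, w x • f.toL2 x = ∫ x, φ x • f.toL2 x := by simp [e5]
      _ = ∫ x, (𝓕⁻ φ : 𝓢(ℝ, ℂ)) x • F x := e2
      _ = ∫ x, F x • (𝓕⁻ φ : 𝓢(ℝ, ℂ)) x := by simp only [smul_eq_mul, mul_comm]
      _ = ∫ x, (𝓕⁻ (F : ℝ → ℂ) : ℝ → ℂ) x • φ x := e3.symm
      _ = ∫ x, w x • (𝓕⁻ (F : ℝ → ℂ) : ℝ → ℂ) x := by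
        simp only [smul_eq_mul, e5, Complex.real_smul, mul_comm]
  refine (memLp_congr_ae heq).mpr ?_
  refine memLp_top_of_bound hcont.aestronglyMeasurable (∫ ξ, ‖F ξ‖) ?_
  refine Eventually.of_forall fun x => ?_
  rw [Real.fourierInv_eq]
  refine (norm_integral_le_integral_norm _).trans_eq ?_
  simp

/-! ### The free Schrödinger group -/

/-- The multiplier `exp(-i t (2πξ)²)` of `e^{it∂ₓ²}`, the Fourier transform being
`𝓕 f ξ = ∫ f x * exp(-2πi x ξ) dx`. -/
def schrodingerSymbol (t ξ : ℝ) : ℂ :=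
  Complex.exp (-(t * (2 * Real.pi * ξ) ^ 2 : ℝ) * Complex.I)

theorem norm_schrodingerSymbol (t ξ : ℝ) : ‖schrodingerSymbol t ξ‖ = 1 := by
  rw [schrodingerSymbol, ← Complex.ofReal_neg, Complex.norm_exp_ofReal_mul_I]

theorem schrodingerSymbol_neg_mul (t ξ : ℝ) :
    schrodingerSymbol (-t) ξ * schrodingerSymbol t ξ = 1 := by
  rw [schrodingerSymbol, schrodingerSymbol, ← Complex.exp_add]
  simp

theorem continuous_schrodingerSymbol (t : ℝ) : Continuous (schrodingerSymbol t) := by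
  unfold schrodingerSymbol
  fun_prop

theorem memLp_symbol_mul (t : ℝ) (f : L2) :
    MemLp (fun ξ => schrodingerSymbol t ξ * f ξ) 2 volume := by
  refine (Lp.memLp f).of_le
    ((continuous_schrodingerSymbol t).aestronglyMeasurable.mul (Lp.aestronglyMeasurable f)) ?_
  exact Eventually.of_forall fun ξ => by simp [norm_schrodingerSymbol]

/-- Multiplication by `exp(-i t (2πξ)²)` on `L²`. -/
def symbolMul (t : ℝ) (f : L2) : L2 := (memLp_symbol_mul t f).toLp

theorem coeFn_symbolMul (t : ℝ) (f : L2) :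
    symbolMul t f =ᵐ[volume] fun ξ => schrodingerSymbol t ξ * f ξ :=
  MemLp.coeFn_toLp _

theorem symbolMul_neg_symbolMul (t : ℝ) (f : L2) : symbolMul (-t) (symbolMul t f) = f := by
  refine Lp.ext ?_
  filter_upwards [coeFn_symbolMul (-t) (symbolMul t f), coeFn_symbolMul t f] with ξ h1 h2
  rw [h1, h2, ← mul_assoc, schrodingerSymbol_neg_mul, one_mul]

/-- Multiplication by `exp(-i t (2πξ)²)`, as a unitary operator on `L²`. -/
def symbolMulₗᵢ (t : ℝ) : L2 ≃ₗᵢ[ℂ] L2 where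
  toFun := symbolMul t
  invFun := symbolMul (-t)
  left_inv := symbolMul_neg_symbolMul t
  right_inv f := by simpa using symbolMul_neg_symbolMul (-t) f
  map_add' f g := by
    refine Lp.ext ?_
    filter_upwards [coeFn_symbolMul t (f + g), coeFn_symbolMul t f, coeFn_symbolMul t g,
      Lp.coeFn_add f g, Lp.coeFn_add (symbolMul t f) (symbolMul t g)] with ξ h1 h2 h3 h4 h5
    change symbolMul t (f + g) ξ = (symbolMul t f + symbolMul t g : L2) ξ
    rw [h1, h5, h4, Pi.add_apply, Pi.add_apply, h2, h3, mul_add]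
  map_smul' c f := by
    refine Lp.ext ?_
    filter_upwards [coeFn_symbolMul t (c • f), coeFn_symbolMul t f,
      Lp.coeFn_smul c f, Lp.coeFn_smul c (symbolMul t f)] with ξ h1 h2 h3 h4
    simp [h1, h2, h3, h4, mul_left_comm]
  norm_map' f := by
    change ‖symbolMul t f‖ = ‖f‖
    rw [Lp.norm_def, Lp.norm_def]
    congr 1
    refine eLpNorm_congr_norm_ae ?_
    filter_upwards [coeFn_symbolMul t f] with ξ h
    rw [h, norm_mul, norm_schrodingerSymbol, one_mul]

/-- `T t = e^{it∂ₓ²}` on `L²(ℝ)`, the solution operator of the free Schrödinger equation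
`i∂ₜu + ∂ₓ²u = 0`. -/
def T (t : ℝ) : L2 ≃ₗᵢ[ℂ] L2 :=
  ((Lp.fourierTransformₗᵢ ℝ ℂ).trans (symbolMulₗᵢ t)).trans (Lp.fourierTransformₗᵢ ℝ ℂ).symm

theorem fourier_T (t : ℝ) (f : L2) : 𝓕 (T t f) = symbolMul t (𝓕 f) :=
  (Lp.fourierTransformₗᵢ ℝ ℂ).apply_symm_apply _

/-- The Schrödinger group commutes with differentiation. -/
theorem IsWeakDeriv.T {f g : L2} (h : IsWeakDeriv f g) (t : ℝ) :
    IsWeakDeriv (T t f) (T t g) := by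
  rw [isWeakDeriv_iff] at h ⊢
  rw [fourier_T, fourier_T]
  filter_upwards [h, coeFn_symbolMul t (𝓕 f), coeFn_symbolMul t (𝓕 g)] with ξ h1 h2 h3
  rw [h3, h2, h1]
  ring

/-- `T t = e^{it∂ₓ²}` on `H¹(ℝ)`. -/
def T₁ (t : ℝ) (f : H1) : H1 := ⟨WithLp.toLp 2 (T t f.toL2, T t f.deriv), f.isWeakDeriv.T t⟩

/-! ### The nonlinearities -/

theorem memLp_power {α : ℝ} (hα : 0 ≤ α) (f : H1) :
    MemLp (fun x => ((‖f.toL2 x‖ ^ α : ℝ) : ℂ) * f.toL2 x) 2 volume := by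
  have hm : AEStronglyMeasurable (fun x => ((‖f.toL2 x‖ ^ α : ℝ) : ℂ)) volume := by
    have h1 : Continuous fun r : ℝ => r ^ α := Real.continuous_rpow_const hα
    exact (Complex.continuous_ofReal.comp h1).comp_aestronglyMeasurable
      (Lp.aestronglyMeasurable f.toL2).norm
  have hC := ae_le_eLpNormEssSup (f := (f.toL2 : ℝ → ℂ)) (μ := volume)
  have hfin : eLpNormEssSup (f.toL2 : ℝ → ℂ) volume ≠ ∞ := by
    have := f.memLp_top.2.ne
    rwa [eLpNorm_exponent_top] at this
  refine (Lp.memLp f.toL2).of_le_mul (c := (eLpNormEssSup (f.toL2 : ℝ → ℂ) volume).toReal ^ α)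
    (hm.mul (Lp.aestronglyMeasurable f.toL2)) ?_
  filter_upwards [hC] with x hx
  rw [norm_mul, Complex.norm_real, Real.norm_of_nonneg (by positivity)]
  gcongr
  rw [← toReal_enorm]
  exact ENNReal.toReal_mono hfin hx

/-- The power nonlinearity `|f|^α f`, for `f ∈ H¹(ℝ)`. -/
def powerNL (α : ℝ) (hα : 0 ≤ α) (f : H1) : L2 := (memLp_power hα f).toLp

/-- The averaged nonlinearity `∫₀¹ T_r⁻¹ (|T_r f|^α T_r f) dr`, for `f ∈ H¹(ℝ)`. -/
def averagedNL (α : ℝ) (hα : 0 ≤ α) (f : H1) : L2 :=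
  ∫ r in (0 : ℝ)..1, (T r).symm (powerNL α hα (T₁ r f))

/-! ### The dispersion map -/

/-- The `2`-periodic function equal to `1` on `[0, 1)` and to `-1` on `[1, 2)`. -/
def d₀ (t : ℝ) : ℝ := if Int.fract (t / 2) < 1 / 2 then 1 else -1

/-- `D(t) = ∫₀ᵗ d₀`. -/
def D (t : ℝ) : ℝ := ∫ s in (0 : ℝ)..t, d₀ s

/-- The dispersion `d(t) = d_av + ε⁻¹ d₀(t / ε)`. -/
def dispersion (dav ε t : ℝ) : ℝ := dav + 1 / ε * d₀ (t / ε)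

/-! ### Solutions -/

/-- `u ∈ C(J, H¹(ℝ))` solves the Cauchy problem
`i∂ₜu + d(t)∂ₓ²u + N(u) = 0`, `u(0) = φ`, on the interval `J ∋ 0`, in the sense of
Duhamel's formula
`u(t) = e^{i(∫₀ᵗ d)∂ₓ²} φ + i ∫₀ᵗ e^{i(∫ₛᵗ d)∂ₓ²} N(u(s)) ds`, where `e^{i(∫ₛᵗ d)∂ₓ²}` is the
propagator of the linear equation `i∂ₜu + d(t)∂ₓ²u = 0`. -/
def IsSolutionOn (d : ℝ → ℝ) (N : H1 → L2) (φ : H1) (J : Set ℝ) (u : ℝ → H1) : Prop :=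
  ContinuousOn u J ∧ ∀ t ∈ J,
    (u t).toL2 = T (∫ r in (0 : ℝ)..t, d r) φ.toL2 +
      Complex.I • ∫ s in (0 : ℝ)..t, T (∫ r in s..t, d r) (N (u s))

/-- The open interval `(-S, S')`, with `S` and `S'` possibly infinite. -/
def lifespan (S S' : EReal) : Set ℝ := {t : ℝ | -S < (t : EReal) ∧ (t : EReal) < S'}

/-- `u` is a maximal solution, with maximal interval of existence `(-S, S')`: it solves the
Cauchy problem on `(-S, S')` and no solution on a strictly larger interval extends it. -/
def IsMaximalSolution (d : ℝ → ℝ) (N : H1 → L2) (φ : H1) (S S' : EReal) (u : ℝ → H1) : Prop :=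
  0 < S ∧ 0 < S' ∧ IsSolutionOn d N φ (lifespan S S') u ∧
    ∀ (R R' : EReal) (w : ℝ → H1), S ≤ R → S' ≤ R' →
      IsSolutionOn d N φ (lifespan R R') w → EqOn w u (lifespan S S') → R = S ∧ R' = S'

/-- The Cauchy problem has a maximal solution, and only one. -/
def HasUniqueMaximalSolution (d : ℝ → ℝ) (N : H1 → L2) (φ : H1) : Prop :=
  ∃ (S S' : EReal) (u : ℝ → H1), IsMaximalSolution d N φ S S' u ∧
    ∀ (R R' : EReal) (w : ℝ → H1), IsMaximalSolution d N φ R R' w →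
      R = S ∧ R' = S' ∧ EqOn w u (lifespan S S')

end DMNLS

end

/-!
Put `θ(t) = ∫₀ᵗ d` and `w(t) = T_{-θ(t)} u(t)`. In this interaction representation the Duhamel
formula of `i∂ₜu + d(t)∂ₓ²u + N(u) = 0` becomes the integral form of the ordinary differential
equation `w' = i T_{θ(t)}⁻¹ N(T_{θ(t)} w)` in the Banach space `H¹(ℝ)` (`isSolutionOn_iff`), provided
that `N` maps `H¹(ℝ)` to itself. The unbounded operator `∂ₓ²` and the discontinuous dispersion are
gone: the vector field is continuous in `(t, w)`, as `T` is a strongly continuous group of isometries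
of `H¹(ℝ)`, and Lipschitz in `w` on balls, uniformly in `t`, if `N` is Lipschitz on balls.

For `N(f) = |f|^α f` with `α ≥ 2` this last property is `lipschitzOnBalls_powerH1`. It rests on the
Sobolev inequality (`exists_sobolev_constant`) and on the chain rule
`∂(|f|^α f) = |f|^α f' + α |f|^(α-2) f Re(conj f f')` (`isWeakDeriv_powerNL`), whose right-hand side
is locally Lipschitz in `(f, f')` as `z ↦ |z|^β z` is locally Lipschitz for every `β ≥ 0`. The
averaged nonlinearity inherits the property. The Picard-Lindelöf theorem gives local existence,
Grönwall's inequality gives uniqueness, and the union of all solutions on open intervals is the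
maximal solution (`IsLocallyWellPosed.exists_isMaximalSolution`).

For the dispersion managed equation `θ(t) = d_av t + D(t / ε)`, so that its vector field is
`G(t, t / ε, w)` with `G` periodic of period `2` in the second variable. Since `D` traverses `[0, 1]`
at unit speed in both directions, the mean of `G` over a period is precisely the vector field of the
averaged equation (`periodMean_conjField`). The theorem is thus an instance of the averaging
principle `exists_solution_near_averaged`: along the averaged solution the difference of the two
vector fields has a small primitive (`eventually_norm_integral_sub_periodMean_le`), and Grönwall's
inequality propagates this smallness. The principle also provides existence up to time `M`, because
it is first applied to a vector field truncated outside a ball, where solutions are global, and the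
truncation is inactive near the averaged solution. Finally `u_ε - T_{D(t/ε)} v` is the image of the
difference of the two solutions `w` under the isometry `T_{θ(t)}`.
-/

noncomputable section

namespace DMNLS

/-! ### The Sobolev space `H¹(ℝ)` -/

theorem isClosed_setOf_isWeakDeriv : IsClosed {p : L2 × L2 | IsWeakDeriv p.1 p.2} := by
  have h1 : Continuous fun f : L2 => (f : 𝓢'(ℝ, ℂ)) :=
    (Lp.toTemperedDistributionCLM ℂ volume 2).continuous
  have h2 : Continuous fun u : 𝓢'(ℝ, ℂ) => ∂_{(1 : ℝ)} u :=
    (LineDeriv.lineDerivOpCLM ℂ 𝓢'(ℝ, ℂ) (1:ℝ)).continuous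
  exact isClosed_eq (h2.comp (h1.comp continuous_fst)) (h1.comp continuous_snd)

instance : CompleteSpace H1 := by
  have h : IsClosed (sobolevH1 : Set (WithLp 2 (L2 × L2))) :=
    isClosed_setOf_isWeakDeriv.preimage (WithLp.prod_continuous_ofLp 2 L2 L2)
  exact h.completeSpace_coe

/-- The inclusion `H¹(ℝ) → L²(ℝ)` as a continuous linear map. -/
def H1.toL2CLM : H1 →L[ℂ] L2 := (WithLp.fstL 2 ℂ L2 L2).comp sobolevH1.subtypeL

/-- Weak differentiation `H¹(ℝ) → L²(ℝ)` as a continuous linear map. -/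
def H1.derivCLM : H1 →L[ℂ] L2 := (WithLp.sndL 2 ℂ L2 L2).comp sobolevH1.subtypeL

theorem H1.norm_sq_eq (f : H1) : ‖f‖ ^ 2 = ‖f.toL2‖ ^ 2 + ‖f.deriv‖ ^ 2 :=
  WithLp.prod_norm_sq_eq_of_L2 (f : WithLp 2 (L2 × L2))

theorem H1.norm_toL2_le (f : H1) : ‖f.toL2‖ ≤ ‖f‖ :=
  le_of_sq_le_sq (by nlinarith [f.norm_sq_eq, sq_nonneg ‖f.deriv‖]) (norm_nonneg _)

theorem H1.norm_deriv_le (f : H1) : ‖f.deriv‖ ≤ ‖f‖ :=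
  le_of_sq_le_sq (by nlinarith [f.norm_sq_eq, sq_nonneg ‖f.toL2‖]) (norm_nonneg _)

theorem H1.norm_le_add (f : H1) : ‖f‖ ≤ ‖f.toL2‖ + ‖f.deriv‖ := by
  refine le_of_sq_le_sq ?_ (by positivity)
  nlinarith [f.norm_sq_eq, mul_nonneg (norm_nonneg f.toL2) (norm_nonneg f.deriv)]

theorem IsWeakDeriv.unique {f g g' : L2} (h : IsWeakDeriv f g) (h' : IsWeakDeriv f g') :
    g = g' :=
  toTemperedDistribution_injective (h.symm.trans h')

theorem H1.toL2_injective : Function.Injective H1.toL2 := by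
  intro f g h
  have h' : f.deriv = g.deriv := f.isWeakDeriv.unique (h ▸ g.isWeakDeriv)
  exact Subtype.ext (WithLp.ofLp_injective 2 (Prod.ext h h'))

/-- The element of `H¹(ℝ)` given by an `L²` function and its weak derivative. -/
def H1.mk (f g : L2) (h : IsWeakDeriv f g) : H1 := ⟨WithLp.toLp 2 (f, g), h⟩

/-- The Sobolev embedding `H¹(ℝ) → L^∞(ℝ)` as a linear map. -/
def H1.toLinfty : H1 →ₗ[ℂ] Lp (α := ℝ) ℂ ∞ volume where
  toFun f := f.memLp_top.toLp
  map_add' f g := by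
    rw [← MemLp.toLp_add]
    exact MemLp.toLp_congr _ _ (Lp.coeFn_add f.toL2 g.toL2)
  map_smul' c f := by
    rw [RingHom.id_apply, ← MemLp.toLp_const_smul]
    exact MemLp.toLp_congr _ _ (Lp.coeFn_smul c f.toL2)

/-- The Sobolev inequality `‖f‖_∞ ≤ C ‖f‖_{H¹}`, from the closed graph theorem: limits in `L²`
and in `L^∞` agree almost everywhere. -/
theorem exists_sobolev_constant :
    ∃ C : ℝ, 0 ≤ C ∧ ∀ f : H1, ∀ᵐ x, ‖f.toL2 x‖ ≤ C * ‖f‖ := by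
  have hc : Continuous H1.toLinfty := by
    refine LinearMap.continuous_of_seq_closed_graph _ fun u x y hu hy => ?_
    have h1 : TendstoInMeasure volume (fun n => (u n).toL2) atTop x.toL2 :=
      tendstoInMeasure_of_tendsto_Lp ((H1.toL2CLM.continuous.tendsto x).comp hu)
    have h2 := tendstoInMeasure_of_tendsto_Lp hy
    have h3 : TendstoInMeasure volume (fun n => (u n).toL2) atTop y :=
      h2.congr_left fun n => MemLp.coeFn_toLp (u n).memLp_top
    refine Lp.ext ((tendstoInMeasure_ae_unique h3 h1).trans ?_)
    exact (MemLp.coeFn_toLp x.memLp_top).symm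
  let Φ : H1 →L[ℂ] Lp (α := ℝ) ℂ ∞ volume := ⟨H1.toLinfty, hc⟩
  refine ⟨‖Φ‖, Φ.opNorm_nonneg, fun f => ?_⟩
  have h1 : ∀ᵐ x, ‖(Φ f : ℝ → ℂ) x‖ ≤ ‖Φ f‖ := by
    have := ae_le_eLpNormEssSup (f := (Φ f : ℝ → ℂ)) (μ := volume)
    filter_upwards [this] with x hx
    rw [Lp.norm_def, eLpNorm_exponent_top, ← toReal_enorm]
    refine ENNReal.toReal_mono ?_ hx
    rw [← eLpNorm_exponent_top]
    exact Lp.eLpNorm_ne_top _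
  filter_upwards [h1, MemLp.coeFn_toLp f.memLp_top] with x hx hx'
  have hx'' : (Φ f : ℝ → ℂ) x = f.toL2 x := hx'
  rw [← hx'']
  exact hx.trans (Φ.le_opNorm f)

theorem hasDerivAt_schwartz (ψ : 𝓢(ℝ, ℂ)) (x : ℝ) :
    HasDerivAt ψ ((∂_{(1 : ℝ)} ψ : 𝓢(ℝ, ℂ)) x) x := by
  have := (ψ.differentiableAt (x := x)).hasDerivAt
  rwa [← fderiv_apply_one_eq_deriv, ← SchwartzMap.lineDerivOp_apply_eq_fderiv] at this

/-- A classical derivative is a weak derivative. -/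
theorem isWeakDeriv_toLp {u u' : ℝ → ℂ} (hu : MemLp u 2 volume) (hu' : MemLp u' 2 volume)
    (h : ∀ x, HasDerivAt u (u' x) x) : IsWeakDeriv (hu.toLp u) (hu'.toLp u') := by
  unfold IsWeakDeriv
  ext ψ
  rw [TemperedDistribution.lineDerivOp_apply_apply, Lp.toTemperedDistribution_apply,
    Lp.toTemperedDistribution_apply]
  have key := integral_mul_deriv_eq_deriv_mul_of_integrable (u := u) (u' := u') (v := ψ)
    (v' := (∂_{(1 : ℝ)} ψ : 𝓢(ℝ, ℂ))) (fun x _ => h x) (fun x _ => hasDerivAt_schwartz ψ x)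
    (hu.integrable_mul ((∂_{(1 : ℝ)} ψ : 𝓢(ℝ, ℂ)).memLp 2 volume))
    (hu'.integrable_mul (ψ.memLp 2 volume)) (hu.integrable_mul (ψ.memLp 2 volume))
  calc ∫ x, (-(∂_{(1 : ℝ)} ψ : 𝓢(ℝ, ℂ))) x • (hu.toLp u : L2) x
      = -∫ x, u x * (∂_{(1 : ℝ)} ψ : 𝓢(ℝ, ℂ)) x := by
        rw [← integral_neg]
        refine integral_congr_ae ?_
        filter_upwards [hu.coeFn_toLp] with x hx
        rw [hx, neg_apply, smul_eq_mul]
        ring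
    _ = ∫ x, u' x * ψ x := by rw [key, neg_neg]
    _ = ∫ x, ψ x • (hu'.toLp u' : L2) x := by
        refine integral_congr_ae ?_
        filter_upwards [hu'.coeFn_toLp] with x hx
        rw [hx, smul_eq_mul, mul_comm]

theorem isWeakDeriv_schwartz (ψ : 𝓢(ℝ, ℂ)) :
    IsWeakDeriv (ψ.toLp 2) ((∂_{(1 : ℝ)} ψ : 𝓢(ℝ, ℂ)).toLp 2) := by
  unfold IsWeakDeriv
  rw [Lp.toTemperedDistribution_toLp_eq, Lp.toTemperedDistribution_toLp_eq,
    TemperedDistribution.lineDerivOp_toTemperedDistributionCLM_eq]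

/-- Schwartz functions as elements of `H¹(ℝ)`. -/
def H1.ofSchwartz : 𝓢(ℝ, ℂ) →ₗ[ℂ] H1 where
  toFun ψ := H1.mk _ _ (isWeakDeriv_schwartz ψ)
  map_add' ψ χ := H1.toL2_injective ((SchwartzMap.toLpCLM ℂ (E := ℝ) ℂ 2 volume).map_add ψ χ)
  map_smul' c ψ := H1.toL2_injective ((SchwartzMap.toLpCLM ℂ (E := ℝ) ℂ 2 volume).map_smul c ψ)

theorem H1.toL2_ofSchwartz (ψ : 𝓢(ℝ, ℂ)) : (H1.ofSchwartz ψ).toL2 = ψ.toLp 2 := rfl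

theorem H1.deriv_ofSchwartz (ψ : 𝓢(ℝ, ℂ)) :
    (H1.ofSchwartz ψ).deriv = (∂_{(1 : ℝ)} ψ : 𝓢(ℝ, ℂ)).toLp 2 := rfl

theorem fourier_injective {f g : L2} (h : 𝓕 f = 𝓕 g) : f = g :=
  (Lp.fourierTransformₗᵢ ℝ ℂ).injective h

/-- The inner product of `H¹(ℝ)` on the Fourier side. -/
theorem H1.inner_eq_integral (f g : H1) :
    inner ℂ f g = ∫ ξ : ℝ, (1 + (2 * Real.pi * ξ) ^ 2 : ℝ) *
      inner ℂ ((𝓕 f.toL2 : L2) ξ) ((𝓕 g.toL2 : L2) ξ) := by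
  have h1 : inner ℂ f g = inner ℂ f.toL2 g.toL2 + inner ℂ f.deriv g.deriv := by
    rw [Submodule.coe_inner, WithLp.prod_inner_apply]
    rfl
  have h2 : ∀ a b : L2, inner ℂ a b = inner ℂ (𝓕 a : L2) (𝓕 b : L2) := fun a b =>
    ((Lp.fourierTransformₗᵢ ℝ ℂ).inner_map_map a b).symm
  rw [h1, h2, h2 f.deriv, L2.inner_def, L2.inner_def,
    ← integral_add (L2.integrable_inner _ _) (L2.integrable_inner _ _)]
  refine integral_congr_ae ?_
  filter_upwards [(isWeakDeriv_iff _ _).mp f.isWeakDeriv, (isWeakDeriv_iff _ _).mp g.isWeakDeriv]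
    with ξ hf hg
  rw [hf, hg]
  simp only [RCLike.inner_apply, map_mul, Complex.conj_I, Complex.conj_ofReal, map_ofNat]
  push_cast
  linear_combination (-(2 * Real.pi * ξ : ℂ) ^ 2 * (𝓕 g.toL2 : L2) ξ *
    (starRingEnd ℂ) ((𝓕 f.toL2 : L2) ξ)) * Complex.I_sq

/-- Schwartz functions are dense in `H¹(ℝ)`: if `f` is orthogonal to them, then its Fourier
transform satisfies `∫ (1 + (2πξ)²) w(ξ) conj (𝓕 f ξ) dξ = 0` for all test functions `w`. -/
theorem H1.denseRange_ofSchwartz : DenseRange H1.ofSchwartz := by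
  have hS : (LinearMap.range H1.ofSchwartz).topologicalClosure = ⊤ := by
    rw [Submodule.topologicalClosure_eq_top_iff, Submodule.eq_bot_iff]
    intro f hf
    have hf0 : (fun ξ : ℝ => (1 + (2 * Real.pi * ξ) ^ 2 : ℝ) *
        (starRingEnd ℂ) ((𝓕 f.toL2 : L2) ξ)) =ᵐ[volume] 0 := by
      refine ae_eq_zero_of_integral_contDiff_smul_eq_zero ?_ fun w hw hc => ?_
      · have hlf : LocallyIntegrable (fun ξ : ℝ => (starRingEnd ℂ) ((𝓕 f.toL2 : L2) ξ)) volume := by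
          refine MemLp.locallyIntegrable (p := 2) ?_ (by norm_num)
          exact (Lp.memLp (𝓕 f.toL2 : L2)).star
        rw [← locallyIntegrableOn_univ] at hlf ⊢
        exact hlf.continuousOn_mul (by fun_prop) isOpen_univ.isLocallyClosed
      · have hg₁ : HasCompactSupport (Complex.ofRealCLM ∘ w) := hc.comp_left rfl
        have hg₂ : ContDiff ℝ (⊤ : ℕ∞) (Complex.ofRealCLM ∘ w) := by fun_prop
        set W : 𝓢(ℝ, ℂ) := hg₁.toSchwartzMap hg₂ with hW
        have h0 := (Submodule.mem_orthogonal' _ _).mp hf (H1.ofSchwartz (𝓕⁻ W))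
          (LinearMap.mem_range_self _ _)
        have hF : (𝓕 (H1.ofSchwartz (𝓕⁻ W)).toL2 : L2) = W.toLp 2 := by
          rw [H1.toL2_ofSchwartz, SchwartzMap.toLp_fourier_eq, FourierTransform.fourier_fourierInv_eq]
        rw [H1.inner_eq_integral, hF] at h0
        rw [← h0]
        refine integral_congr_ae ?_
        filter_upwards [W.coeFn_toLp 2 volume] with ξ hξ
        have hw : W ξ = (w ξ : ℂ) := rfl
        rw [hξ, hw, Complex.real_smul, RCLike.inner_apply]
        ring
    refine H1.toL2_injective (fourier_injective (Lp.ext ?_))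
    have hz : (𝓕 (0 : H1).toL2 : L2) = 0 := (Lp.fourierTransformₗᵢ ℝ ℂ).map_zero
    rw [hz]
    filter_upwards [hf0, Lp.coeFn_zero ℂ 2 (volume : Measure ℝ)] with ξ hξ h0
    have hne : ((1 + (2 * Real.pi * ξ) ^ 2 : ℝ) : ℂ) ≠ 0 :=
      Complex.ofReal_ne_zero.mpr (by positivity)
    rw [h0]
    have h1 := (mul_eq_zero.mp hξ).resolve_left hne
    simpa using h1
  have h := congrArg (fun S : Submodule ℂ H1 => (S : Set H1)) hS
  rw [DenseRange, dense_iff_closure_eq]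
  rw [← LinearMap.coe_range, ← Submodule.topologicalClosure_coe]
  exact h

/-! ### The Schrödinger group on `H¹(ℝ)` -/

theorem schrodingerSymbol_add (s t ξ : ℝ) :
    schrodingerSymbol (s + t) ξ = schrodingerSymbol s ξ * schrodingerSymbol t ξ := by
  rw [schrodingerSymbol, schrodingerSymbol, schrodingerSymbol, ← Complex.exp_add]
  push_cast
  ring_nf

theorem symbolMul_add (s t : ℝ) (f : L2) :
    symbolMul (s + t) f = symbolMul s (symbolMul t f) := by
  refine Lp.ext ?_
  filter_upwards [coeFn_symbolMul (s + t) f, coeFn_symbolMul s (symbolMul t f),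
    coeFn_symbolMul t f] with ξ h1 h2 h3
  rw [h1, h2, h3, schrodingerSymbol_add, mul_assoc]

theorem T_add (s t : ℝ) (f : L2) : T (s + t) f = T s (T t f) :=
  fourier_injective (by rw [fourier_T, fourier_T, fourier_T, symbolMul_add])

theorem T_zero (f : L2) : T 0 f = f := by
  apply (T 0).injective
  rw [← T_add, zero_add]

theorem T_symm_apply (t : ℝ) (f : L2) : (T t).symm f = T (-t) f := by
  apply (T t).injective
  rw [LinearIsometryEquiv.apply_symm_apply, ← T_add, add_neg_cancel, T_zero]

/-- The Schrödinger group is strongly continuous on `L²(ℝ)`. As it is unitary it suffices that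
`⟪f, T t f⟫` is continuous in `t`, which is dominated convergence on the Fourier side. -/
theorem continuous_T (f : L2) : Continuous fun t => T t f := by
  have h1 : Continuous fun t => inner ℂ f (T t f) := by
    have h2 : ∀ t, inner ℂ f (T t f) =
        ∫ ξ, schrodingerSymbol t ξ * inner ℂ ((𝓕 f : L2) ξ) ((𝓕 f : L2) ξ) := by
      intro t
      have : inner ℂ f (T t f) = inner ℂ (𝓕 f : L2) (𝓕 (T t f) : L2) :=
        ((Lp.fourierTransformₗᵢ ℝ ℂ).inner_map_map f (T t f)).symm
      rw [this, fourier_T, L2.inner_def]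
      refine integral_congr_ae ?_
      filter_upwards [coeFn_symbolMul t (𝓕 f)] with ξ hξ
      rw [hξ, RCLike.inner_apply, RCLike.inner_apply, mul_assoc]
    simp_rw [h2]
    have hi := L2.integrable_inner (𝕜 := ℂ) (𝓕 f : L2) (𝓕 f : L2)
    refine continuous_of_dominated (fun t => ?_) (fun t => ?_) hi.norm ?_
    · exact (continuous_schrodingerSymbol t).aestronglyMeasurable.mul hi.aestronglyMeasurable
    · refine Eventually.of_forall fun ξ => ?_
      rw [norm_mul, norm_schrodingerSymbol, one_mul]
    · refine Eventually.of_forall fun ξ => ?_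
      unfold schrodingerSymbol
      fun_prop
  rw [continuous_iff_continuousAt]
  intro t
  rw [ContinuousAt, tendsto_iff_norm_sub_tendsto_zero]
  have h3 : ∀ s, ‖T s f - T t f‖ ^ 2 = 2 * ‖f‖ ^ 2 - 2 * (inner ℂ f (T (s - t) f)).re := by
    intro s
    have e : T s f = T t (T (s - t) f) := by rw [← T_add, add_sub_cancel]
    rw [e, ← map_sub, LinearIsometryEquiv.norm_map, norm_sub_sq (𝕜 := ℂ),
      LinearIsometryEquiv.norm_map, inner_re_symm]
    simp only [RCLike.re_to_complex]
    ring
  have h4 : Tendsto (fun s => ‖T s f - T t f‖ ^ 2) (𝓝 t) (𝓝 0) := by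
    simp_rw [h3]
    have h5 : Continuous fun s => 2 * ‖f‖ ^ 2 - 2 * (inner ℂ f (T (s - t) f)).re := by
      have := h1.comp (continuous_id.sub (continuous_const (y := t)))
      exact continuous_const.sub (continuous_const.mul (Complex.continuous_re.comp this))
    have h6 := h5.tendsto t
    rw [sub_self, T_zero, inner_self_eq_norm_sq_to_K] at h6
    have h8 : (((‖f‖ : ℝ) : ℂ) ^ 2).re = ‖f‖ ^ 2 := by
      rw [← Complex.ofReal_pow, Complex.ofReal_re]
    simpa [h8] using h6
  have h7 := h4.sqrt
  simpa [Real.sqrt_sq (norm_nonneg _)] using h7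

@[simp] theorem H1.toL2_T₁ (t : ℝ) (f : H1) : (T₁ t f).toL2 = T t f.toL2 := rfl

@[simp] theorem H1.deriv_T₁ (t : ℝ) (f : H1) : (T₁ t f).deriv = T t f.deriv := rfl

/-- `T₁ t` as a linear isometry of `H¹(ℝ)`. -/
def T₁ₗᵢ (t : ℝ) : H1 →ₗᵢ[ℂ] H1 where
  toFun := T₁ t
  map_add' f g := H1.toL2_injective ((T t).map_add f.toL2 g.toL2)
  map_smul' c f := H1.toL2_injective ((T t).map_smul c f.toL2)
  norm_map' f := by
    have h : ‖T₁ t f‖ ^ 2 = ‖f‖ ^ 2 := by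
      rw [H1.norm_sq_eq, H1.norm_sq_eq, H1.toL2_T₁, H1.deriv_T₁, LinearIsometryEquiv.norm_map,
        LinearIsometryEquiv.norm_map]
    exact (sq_eq_sq₀ (norm_nonneg _) (norm_nonneg _)).mp h

theorem T₁_sub_apply (t : ℝ) (f g : H1) : T₁ t (f - g) = T₁ t f - T₁ t g := (T₁ₗᵢ t).map_sub f g

theorem T₁_smul (t : ℝ) (c : ℂ) (f : H1) : T₁ t (c • f) = c • T₁ t f := (T₁ₗᵢ t).map_smul c f

theorem T₁_map_zero (t : ℝ) : T₁ t 0 = 0 := (T₁ₗᵢ t).map_zero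

theorem norm_T₁ (t : ℝ) (f : H1) : ‖T₁ t f‖ = ‖f‖ := (T₁ₗᵢ t).norm_map f

theorem T₁_add (s t : ℝ) (f : H1) : T₁ (s + t) f = T₁ s (T₁ t f) :=
  H1.toL2_injective (T_add s t f.toL2)

theorem T₁_zero (f : H1) : T₁ 0 f = f := H1.toL2_injective (T_zero f.toL2)

theorem continuous_H1_iff {X : Type*} [TopologicalSpace X] {f : X → H1} :
    Continuous f ↔ Continuous (fun x => (f x).toL2) ∧ Continuous (fun x => (f x).deriv) := by
  refine ⟨fun h => ⟨H1.toL2CLM.continuous.comp h, H1.derivCLM.continuous.comp h⟩, fun h => ?_⟩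
  exact Continuous.subtype_mk ((WithLp.prod_continuous_toLp 2 L2 L2).comp (h.1.prodMk h.2)) _

theorem continuous_T₁ (f : H1) : Continuous fun t => T₁ t f :=
  continuous_H1_iff.mpr ⟨continuous_T f.toL2, continuous_T f.deriv⟩

/-- The Schrödinger group is jointly continuous on `ℝ × H¹(ℝ)`. -/
theorem continuous_uncurry_T₁ : Continuous fun p : ℝ × H1 => T₁ p.1 p.2 :=
  continuous_prod_of_continuous_lipschitzWith' _ 1
    (fun t => (T₁ₗᵢ t).lipschitz) continuous_T₁

/-! ### The pointwise nonlinearity -/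

/-- Bernoulli's inequality for the ratio `b / a`, cleared of denominators. -/
theorem rpow_sub_rpow_le {a b p : ℝ} (hb : 0 ≤ b) (hab : b ≤ a) (hp : 1 ≤ p) :
    a ^ p - b ^ p ≤ p * a ^ (p - 1) * (a - b) := by
  rcases (hb.trans hab).eq_or_lt with rfl | ha
  · simp [le_antisymm hab hb]
  have h1 : -1 ≤ (b - a) / a := by
    rw [le_div_iff₀ ha]
    linarith
  have h2 := one_add_mul_self_le_rpow_one_add h1 hp
  have h3 : 1 + (b - a) / a = b / a := by
    field_simp
    ring
  rw [h3, Real.div_rpow hb ha.le, le_div_iff₀ (Real.rpow_pos_of_pos ha p)] at h2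
  have h4 : a ^ p = a ^ (p - 1) * a := by
    rw [← Real.rpow_add_one ha.ne', sub_add_cancel]
  have h5 : (1 + p * ((b - a) / a)) * a ^ p = a ^ p - p * a ^ (p - 1) * (a - b) := by
    rw [h4]
    field_simp
    ring
  linarith

theorem abs_norm_rpow_sub_le {E : Type*} [SeminormedAddCommGroup E] {p R : ℝ} (hp : 1 ≤ p)
    {z w : E} (hz : ‖z‖ ≤ R) (hw : ‖w‖ ≤ R) :
    |‖z‖ ^ p - ‖w‖ ^ p| ≤ p * R ^ (p - 1) * ‖z - w‖ := by
  wlog h : ‖w‖ ≤ ‖z‖ generalizing z w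
  · rw [abs_sub_comm, norm_sub_rev]
    exact this hw hz (le_of_not_ge h)
  rw [abs_of_nonneg (sub_nonneg.mpr (by gcongr))]
  refine (rpow_sub_rpow_le (norm_nonneg w) h hp).trans ?_
  have : 0 ≤ p - 1 := by linarith
  gcongr
  · exact mul_nonneg (by linarith) (Real.rpow_nonneg ((norm_nonneg z).trans hz) _)
  · exact norm_sub_norm_le z w

/-- The pointwise nonlinearity `z ↦ |z|^β z`. -/
def powMul (β : ℝ) (z : ℂ) : ℂ := ((‖z‖ ^ β : ℝ) : ℂ) * z

theorem norm_powMul (β : ℝ) (z : ℂ) : ‖powMul β z‖ = ‖z‖ ^ β * ‖z‖ := by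
  rw [powMul, norm_mul, Complex.norm_real, Real.norm_of_nonneg (by positivity)]

/-- The map `z ↦ |z|^β z` is locally Lipschitz for all `β ≥ 0`, although `z ↦ |z|^β` need not be for
`β < 1`: the difference of the latter comes with a factor `|w|`, which makes it a difference of
powers with exponent `β + 1 ≥ 1`. -/
theorem norm_powMul_sub_le {β R : ℝ} (hβ : 0 ≤ β) {z w : ℂ} (hz : ‖z‖ ≤ R) (hw : ‖w‖ ≤ R) :
    ‖powMul β z - powMul β w‖ ≤ (1 + β) * R ^ β * ‖z - w‖ := by
  wlog h : ‖w‖ ≤ ‖z‖ generalizing z w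
  · rw [norm_sub_rev, norm_sub_rev z]
    exact this hw hz (le_of_not_ge h)
  have e : powMul β z - powMul β w =
      ((‖z‖ ^ β : ℝ) : ℂ) * (z - w) + ((‖z‖ ^ β - ‖w‖ ^ β : ℝ) : ℂ) * w := by
    simp only [powMul]
    push_cast
    ring
  have h0 : 0 ≤ ‖z‖ ^ β - ‖w‖ ^ β := sub_nonneg.mpr (by gcongr)
  have h1 : ‖z‖ ^ (β + 1) - ‖w‖ ^ (β + 1) ≤ (β + 1) * ‖z‖ ^ β * (‖z‖ - ‖w‖) := by
    simpa using rpow_sub_rpow_le (norm_nonneg w) h (p := β + 1) (by linarith)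
  rw [Real.rpow_add_one' (norm_nonneg z) (by linarith),
    Real.rpow_add_one' (norm_nonneg w) (by linarith)] at h1
  have h2 : (‖z‖ ^ β - ‖w‖ ^ β) * ‖w‖ ≤ β * ‖z‖ ^ β * ‖z - w‖ := by
    have h3 : ‖z‖ - ‖w‖ ≤ ‖z - w‖ := norm_sub_norm_le z w
    have h4 : 0 ≤ β * ‖z‖ ^ β := by positivity
    nlinarith [mul_le_mul_of_nonneg_left h3 h4]
  have h5 : ‖z‖ ^ β ≤ R ^ β := by gcongr
  calc ‖powMul β z - powMul β w‖
      ≤ ‖z‖ ^ β * ‖z - w‖ + (‖z‖ ^ β - ‖w‖ ^ β) * ‖w‖ := by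
        rw [e]
        refine (norm_add_le _ _).trans_eq ?_
        rw [norm_mul, norm_mul, Complex.norm_real, Complex.norm_real, Real.norm_of_nonneg h0,
          Real.norm_of_nonneg (by positivity)]
    _ ≤ (1 + β) * ‖z‖ ^ β * ‖z - w‖ := by linarith
    _ ≤ (1 + β) * R ^ β * ‖z - w‖ := by gcongr

/-- The real derivative of `z ↦ |z|^α z` at `z` in the direction `h`. -/
def powMulDeriv (α : ℝ) (z h : ℂ) : ℂ :=
  ((‖z‖ ^ α : ℝ) : ℂ) * h + α * powMul (α - 2) z * (inner ℝ z h : ℝ)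

theorem hasDerivAt_powMul_comp {α : ℝ} (hα : 2 ≤ α) {f : ℝ → ℂ} {f' : ℂ} {x : ℝ}
    (hf : HasDerivAt f f' x) :
    HasDerivAt (fun y => powMul α (f y)) (powMulDeriv α (f x) f') x := by
  have h1 := (hasFDerivAt_norm_rpow (f x) (p := α) (by linarith)).comp_hasDerivAt x hf
  have h2 := h1.ofReal_comp.mul hf
  refine h2.congr_deriv ?_
  simp only [powMulDeriv, powMul, smul_apply, innerSL_apply_apply,
    Function.comp_apply, smul_eq_mul]
  push_cast
  ring

theorem norm_powMulDeriv_sub_le {α R : ℝ} (hα : 2 ≤ α) {z w h k : ℂ} (hz : ‖z‖ ≤ R)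
    (hw : ‖w‖ ≤ R) :
    ‖powMulDeriv α z h - powMulDeriv α w k‖ ≤
      (R ^ α + α * (R ^ (α - 2) * R) * R) * ‖h - k‖ +
      (α * R ^ (α - 1) + α * ((1 + (α - 2)) * R ^ (α - 2)) * R + α * (R ^ (α - 2) * R)) *
        ‖z - w‖ * ‖k‖ := by
  have hR : 0 ≤ R := (norm_nonneg z).trans hz
  have hα0 : 0 ≤ α := by linarith
  have hα2 : 0 ≤ α - 2 := by linarith
  have hreal : ∀ r : ℝ, ‖(r : ℂ)‖ = |r| := fun r => by rw [Complex.norm_real, Real.norm_eq_abs]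
  have hpow : ∀ u : ℂ, ‖u‖ ≤ R → ‖powMul (α - 2) u‖ ≤ R ^ (α - 2) * R := fun u hu => by
    rw [norm_powMul]
    gcongr
  -- The factors `|z|^α`, `|z|^(α-2) z` and `z` are exchanged for those with `w` one at a time.
  have e : powMulDeriv α z h - powMulDeriv α w k =
      ((‖z‖ ^ α : ℝ) : ℂ) * (h - k)
      + α * powMul (α - 2) z * (inner ℝ z (h - k) : ℝ)
      + ((‖z‖ ^ α - ‖w‖ ^ α : ℝ) : ℂ) * k
      + α * (powMul (α - 2) z - powMul (α - 2) w) * (inner ℝ z k : ℝ)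
      + α * powMul (α - 2) w * (inner ℝ (z - w) k : ℝ) := by
    simp only [powMulDeriv, inner_sub_left, inner_sub_right]
    push_cast
    ring
  have b1 : ‖((‖z‖ ^ α : ℝ) : ℂ) * (h - k)‖ ≤ R ^ α * ‖h - k‖ := by
    rw [norm_mul, hreal, abs_of_nonneg (by positivity)]
    gcongr
  have b2 : ‖(α : ℂ) * powMul (α - 2) z * (inner ℝ z (h - k) : ℝ)‖ ≤
      α * (R ^ (α - 2) * R) * (R * ‖h - k‖) := by
    rw [norm_mul, norm_mul, hreal, hreal, abs_of_nonneg hα0]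
    have := (abs_real_inner_le_norm z (h - k)).trans
      (mul_le_mul_of_nonneg_right hz (norm_nonneg (h - k)))
    gcongr
    exact hpow z hz
  have b3 : ‖((‖z‖ ^ α - ‖w‖ ^ α : ℝ) : ℂ) * k‖ ≤ α * R ^ (α - 1) * ‖z - w‖ * ‖k‖ := by
    rw [norm_mul, hreal]
    gcongr
    exact abs_norm_rpow_sub_le (by linarith) hz hw
  have b4 : ‖(α : ℂ) * (powMul (α - 2) z - powMul (α - 2) w) * (inner ℝ z k : ℝ)‖ ≤
      α * ((1 + (α - 2)) * R ^ (α - 2) * ‖z - w‖) * (R * ‖k‖) := by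
    rw [norm_mul, norm_mul, hreal, hreal, abs_of_nonneg hα0]
    have := (abs_real_inner_le_norm z k).trans
      (mul_le_mul_of_nonneg_right hz (norm_nonneg k))
    gcongr
    exact norm_powMul_sub_le hα2 hz hw
  have b5 : ‖(α : ℂ) * powMul (α - 2) w * (inner ℝ (z - w) k : ℝ)‖ ≤
      α * (R ^ (α - 2) * R) * (‖z - w‖ * ‖k‖) := by
    rw [norm_mul, norm_mul, hreal, hreal, abs_of_nonneg hα0]
    have := abs_real_inner_le_norm (z - w) k
    gcongr
    exact hpow w hw
  rw [e]
  refine (norm_add_le _ _).trans ?_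
  refine (add_le_add_left (norm_add_le _ _) _).trans ?_
  refine (add_le_add_left (add_le_add_left (norm_add_le _ _) _) _).trans ?_
  refine (add_le_add_left (add_le_add_left (add_le_add_left (norm_add_le _ _) _) _) _).trans ?_
  linarith

/-! ### The nonlinearity on `H¹(ℝ)` -/

/-- `N` is Lipschitz on every ball around the origin. -/
def LipschitzOnBalls {X Y : Type*} [SeminormedAddCommGroup X] [SeminormedAddCommGroup Y]
    (N : X → Y) : Prop :=
  ∀ R : ℝ, ∃ L : ℝ, 0 ≤ L ∧ ∀ x y, ‖x‖ ≤ R → ‖y‖ ≤ R → ‖N x - N y‖ ≤ L * ‖x - y‖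

theorem LipschitzOnBalls.continuous {X Y : Type*} [SeminormedAddCommGroup X]
    [SeminormedAddCommGroup Y] {N : X → Y} (h : LipschitzOnBalls N) : Continuous N := by
  rw [continuous_iff_continuousAt]
  intro x
  obtain ⟨L, hL0, hL⟩ := h (‖x‖ + 1)
  have h1 : ∀ᶠ y in 𝓝 x, ‖y‖ ≤ ‖x‖ + 1 :=
    (continuous_norm.tendsto x).eventually (eventually_le_nhds (lt_add_one _))
  rw [ContinuousAt, tendsto_iff_norm_sub_tendsto_zero]
  have h2 : Tendsto (fun y => L * ‖y - x‖) (𝓝 x) (𝓝 0) := by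
    have : Continuous fun y => L * ‖y - x‖ := by fun_prop
    simpa using this.tendsto x
  refine squeeze_zero' (Eventually.of_forall fun _ => norm_nonneg _) ?_ h2
  filter_upwards [h1] with y hy
  exact hL y x hy (by linarith)

theorem norm_le_add_of_ae_le {F G K : L2} {A B : ℝ} (hA : 0 ≤ A) (hB : 0 ≤ B)
    (h : ∀ᵐ x, ‖F x‖ ≤ A * ‖G x‖ + B * ‖K x‖) : ‖F‖ ≤ A * ‖G‖ + B * ‖K‖ := by
  let G' : Lp (α := ℝ) ℝ 2 volume := (Lp.memLp G).norm.toLp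
  let K' : Lp (α := ℝ) ℝ 2 volume := (Lp.memLp K).norm.toLp
  have hG : ‖G'‖ = ‖G‖ := by rw [Lp.norm_toLp, eLpNorm_norm, Lp.norm_def]
  have hK : ‖K'‖ = ‖K‖ := by rw [Lp.norm_toLp, eLpNorm_norm, Lp.norm_def]
  have h1 : ‖F‖ ≤ ‖A • G' + B • K'‖ := by
    refine Lp.norm_le_norm_of_ae_le ?_
    filter_upwards [h, MemLp.coeFn_toLp (Lp.memLp G).norm, MemLp.coeFn_toLp (Lp.memLp K).norm,
      Lp.coeFn_add (A • G') (B • K'), Lp.coeFn_smul A G', Lp.coeFn_smul B K'] with x h hg hk h1 h2 h3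
    rw [h1, Pi.add_apply, h2, h3, Pi.smul_apply, Pi.smul_apply]
    refine h.trans ((le_of_eq ?_).trans (le_abs_self _))
    rw [hg, hk, smul_eq_mul, smul_eq_mul]
  refine h1.trans ((norm_add_le _ _).trans_eq ?_)
  rw [norm_smul, norm_smul, hG, hK, Real.norm_of_nonneg hA, Real.norm_of_nonneg hB]

theorem coeFn_powerNL {α : ℝ} (hα : 0 ≤ α) (f : H1) :
    powerNL α hα f =ᵐ[volume] fun x => powMul α (f.toL2 x) :=
  MemLp.coeFn_toLp _

theorem continuous_powMul {α : ℝ} (hα : 0 ≤ α) : Continuous (powMul α) :=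
  LipschitzOnBalls.continuous fun R => by
    by_cases hR : 0 ≤ R
    · exact ⟨(1 + α) * R ^ α, by positivity, fun z w hz hw => norm_powMul_sub_le hα hz hw⟩
    · exact ⟨0, le_rfl, fun z w hz => absurd ((norm_nonneg z).trans hz) hR⟩

theorem continuous_powMulDeriv {α : ℝ} (hα : 2 ≤ α) :
    Continuous (Function.uncurry (powMulDeriv α)) := by
  have h1 : Continuous fun p : ℂ × ℂ => ‖p.1‖ ^ α :=
    (Real.continuous_rpow_const (by linarith)).comp (continuous_norm.comp continuous_fst)
  have h2 : Continuous fun p : ℂ × ℂ => powMul (α - 2) p.1 :=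
    (continuous_powMul (by linarith)).comp continuous_fst
  have h3 : Continuous fun p : ℂ × ℂ => inner ℝ p.1 p.2 := continuous_fst.inner continuous_snd
  exact ((Complex.continuous_ofReal.comp h1).mul continuous_snd).add
    ((continuous_const.mul h2).mul (Complex.continuous_ofReal.comp h3))

theorem memLp_powMulDeriv {α : ℝ} (hα : 2 ≤ α) (f : H1) :
    MemLp (fun x => powMulDeriv α (f.toL2 x) (f.deriv x)) 2 volume := by
  obtain ⟨C, hC0, hC⟩ := exists_sobolev_constant
  have hm : AEStronglyMeasurable (fun x => powMulDeriv α (f.toL2 x) (f.deriv x)) volume :=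
    (continuous_powMulDeriv hα).comp_aestronglyMeasurable₂
      (Lp.aestronglyMeasurable f.toL2) (Lp.aestronglyMeasurable f.deriv)
  refine (Lp.memLp f.deriv).of_le_mul hm (c := (C * ‖f‖) ^ α +
    α * ((C * ‖f‖) ^ (α - 2) * (C * ‖f‖)) * (C * ‖f‖)) ?_
  filter_upwards [hC f] with x hx
  have h := norm_powMulDeriv_sub_le hα (h := f.deriv x) (k := 0) hx hx
  have h0 : powMulDeriv α (f.toL2 x) 0 = 0 := by
    simp only [powMulDeriv, inner_zero_right, mul_zero, Complex.ofReal_zero, add_zero]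
  rwa [h0, sub_zero, sub_zero, norm_zero, mul_zero, add_zero] at h

/-- The weak derivative of `|f|^α f`, for `f ∈ H¹(ℝ)`. -/
def powerNLDeriv (α : ℝ) (hα : 2 ≤ α) (f : H1) : L2 := (memLp_powMulDeriv hα f).toLp

theorem lipschitzOnBalls_powerNL {α : ℝ} (hα : 0 ≤ α) : LipschitzOnBalls (powerNL α hα) := by
  obtain ⟨C, hC0, hC⟩ := exists_sobolev_constant
  intro R
  by_cases hR : 0 ≤ R
  swap
  · exact ⟨0, le_rfl, fun f g hf => absurd ((norm_nonneg f).trans hf) hR⟩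
  refine ⟨(1 + α) * (C * R) ^ α, by positivity, fun f g hf hg => ?_⟩
  have h1 : ‖powerNL α hα f - powerNL α hα g‖ ≤ (1 + α) * (C * R) ^ α * ‖f.toL2 - g.toL2‖ := by
    refine Lp.norm_le_mul_norm_of_ae_le_mul ?_
    filter_upwards [hC f, hC g, coeFn_powerNL hα f, coeFn_powerNL hα g,
      Lp.coeFn_sub f.toL2 g.toL2, Lp.coeFn_sub (powerNL α hα f) (powerNL α hα g)]
      with x hf' hg' h1 h2 h3 h4
    rw [h3, h4, Pi.sub_apply, Pi.sub_apply, h1, h2]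
    exact norm_powMul_sub_le hα (hf'.trans (by gcongr)) (hg'.trans (by gcongr))
  exact h1.trans (by gcongr; exact (f - g).norm_toL2_le)

theorem lipschitzOnBalls_powerNLDeriv {α : ℝ} (hα : 2 ≤ α) :
    LipschitzOnBalls (powerNLDeriv α hα) := by
  obtain ⟨C, hC0, hC⟩ := exists_sobolev_constant
  intro R
  by_cases hR : 0 ≤ R
  swap
  · exact ⟨0, le_rfl, fun f g hf => absurd ((norm_nonneg f).trans hf) hR⟩
  have hα2 : 0 ≤ α - 2 := by linarith
  set ρ := C * R with hρ
  set A := ρ ^ α + α * (ρ ^ (α - 2) * ρ) * ρ with hA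
  set B := α * ρ ^ (α - 1) + α * ((1 + (α - 2)) * ρ ^ (α - 2)) * ρ + α * (ρ ^ (α - 2) * ρ) with hB
  have hA0 : 0 ≤ A := by positivity
  have hB0 : 0 ≤ B := by positivity
  refine ⟨A + B * C * R, by positivity, fun f g hf hg => ?_⟩
  have h1 : ‖powerNLDeriv α hα f - powerNLDeriv α hα g‖ ≤
      A * ‖f.deriv - g.deriv‖ + B * (C * ‖f - g‖) * ‖g.deriv‖ := by
    refine norm_le_add_of_ae_le hA0 (by positivity) ?_
    filter_upwards [hC f, hC g, hC (f - g), (memLp_powMulDeriv hα f).coeFn_toLp,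
      (memLp_powMulDeriv hα g).coeFn_toLp, Lp.coeFn_sub f.toL2 g.toL2,
      Lp.coeFn_sub f.deriv g.deriv, Lp.coeFn_sub (powerNLDeriv α hα f) (powerNLDeriv α hα g)]
      with x hf' hg' hfg h1 h2 h3 h4 h5
    have h6 : ‖f.toL2 x - g.toL2 x‖ ≤ C * ‖f - g‖ := by
      rw [← Pi.sub_apply, ← h3]
      exact hfg
    rw [h4, h5, Pi.sub_apply, Pi.sub_apply, powerNLDeriv, powerNLDeriv, h1, h2]
    have hf'' : ‖f.toL2 x‖ ≤ ρ := hf'.trans (by rw [hρ]; gcongr)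
    have hg'' : ‖g.toL2 x‖ ≤ ρ := hg'.trans (by rw [hρ]; gcongr)
    refine (norm_powMulDeriv_sub_le hα hf'' hg'').trans ?_
    rw [← hA, ← hB]
    gcongr
  have h2 : ‖f.deriv - g.deriv‖ ≤ ‖f - g‖ := (f - g).norm_deriv_le
  have h3 : ‖g.deriv‖ ≤ R := g.norm_deriv_le.trans hg
  calc _ ≤ A * ‖f - g‖ + B * (C * ‖f - g‖) * R := h1.trans (by gcongr)
    _ = _ := by ring

/-- The chain rule in `H¹(ℝ)`. It holds classically for Schwartz functions, and passes to limits
in `H¹(ℝ)` because both sides are continuous in `f`. -/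
theorem isWeakDeriv_powerNL {α : ℝ} (hα : 2 ≤ α) (f : H1) :
    IsWeakDeriv (powerNL α (zero_le_two.trans hα) f) (powerNLDeriv α hα f) := by
  have hc : IsClosed {f : H1 |
      IsWeakDeriv (powerNL α (zero_le_two.trans hα) f) (powerNLDeriv α hα f)} :=
    isClosed_setOf_isWeakDeriv.preimage
      ((lipschitzOnBalls_powerNL (zero_le_two.trans hα)).continuous.prodMk
        (lipschitzOnBalls_powerNLDeriv hα).continuous)
  refine H1.denseRange_ofSchwartz.induction_on f hc fun ψ => ?_
  have h1 : (fun x => powMul α ((H1.ofSchwartz ψ).toL2 x)) =ᵐ[volume] fun x => powMul α (ψ x) := by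
    filter_upwards [ψ.coeFn_toLp 2 volume] with x hx
    rw [H1.toL2_ofSchwartz, hx]
  have h2 : (fun x => powMulDeriv α ((H1.ofSchwartz ψ).toL2 x) ((H1.ofSchwartz ψ).deriv x))
      =ᵐ[volume] fun x => powMulDeriv α (ψ x) ((∂_{(1 : ℝ)} ψ : 𝓢(ℝ, ℂ)) x) := by
    filter_upwards [ψ.coeFn_toLp 2 volume, (∂_{(1 : ℝ)} ψ : 𝓢(ℝ, ℂ)).coeFn_toLp 2 volume]
      with x hx hx'
    rw [H1.toL2_ofSchwartz, hx, H1.deriv_ofSchwartz, hx']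
  have m1 := (memLp_congr_ae h1).mp (memLp_power (zero_le_two.trans hα) (H1.ofSchwartz ψ))
  have m2 := (memLp_congr_ae h2).mp (memLp_powMulDeriv hα (H1.ofSchwartz ψ))
  have key := isWeakDeriv_toLp m1 m2 fun x => hasDerivAt_powMul_comp hα (hasDerivAt_schwartz ψ x)
  have e1 : powerNL α (zero_le_two.trans hα) (H1.ofSchwartz ψ) = m1.toLp _ :=
    MemLp.toLp_congr _ _ h1
  have e2 : powerNLDeriv α hα (H1.ofSchwartz ψ) = m2.toLp _ := MemLp.toLp_congr _ _ h2
  change IsWeakDeriv _ _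
  rwa [e1, e2]

/-- The power nonlinearity as a map of `H¹(ℝ)` to itself. -/
def powerH1 (α : ℝ) (hα : 2 ≤ α) (f : H1) : H1 := H1.mk _ _ (isWeakDeriv_powerNL hα f)

theorem toL2_powerH1 {α : ℝ} (hα : 2 ≤ α) (f : H1) :
    (powerH1 α hα f).toL2 = powerNL α (zero_le_two.trans hα) f := rfl

theorem lipschitzOnBalls_powerH1 {α : ℝ} (hα : 2 ≤ α) : LipschitzOnBalls (powerH1 α hα) := by
  intro R
  obtain ⟨L, hL0, hL⟩ := lipschitzOnBalls_powerNL (zero_le_two.trans hα) R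
  obtain ⟨L', hL0', hL'⟩ := lipschitzOnBalls_powerNLDeriv hα R
  refine ⟨L + L', by positivity, fun f g hf hg => ?_⟩
  rw [add_mul]
  exact (H1.norm_le_add _).trans (add_le_add (hL f g hf hg) (hL' f g hf hg))

theorem powerH1_zero {α : ℝ} (hα : 2 ≤ α) : powerH1 α hα 0 = 0 := by
  refine H1.toL2_injective (Lp.ext ?_)
  have hz : (0 : H1).toL2 = 0 := rfl
  rw [toL2_powerH1, hz]
  filter_upwards [coeFn_powerNL (zero_le_two.trans hα) 0, Lp.coeFn_zero ℂ 2 (volume : Measure ℝ)]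
    with x h1 h2
  rw [h1, hz, h2]
  simp [powMul]

section ODE

variable {E : Type*} [NormedAddCommGroup E] [NormedSpace ℝ E]

/-! ### Integral equations -/

/-- A function continuous on a compact interval extends continuously to the line, by constants. -/
theorem exists_continuous_eqOn_uIcc {X : Type*} [TopologicalSpace X] {g : ℝ → X} {a b : ℝ}
    (hg : ContinuousOn g (uIcc a b)) : ∃ g' : ℝ → X, Continuous g' ∧ EqOn g' g (uIcc a b) := by
  have h : min a b ≤ max a b := min_le_max
  have hc : Continuous ((Icc (min a b) (max a b)).domRestrict g) := ContinuousOn.domRestrict hg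
  exact ⟨IccExtend h ((Icc (min a b) (max a b)).domRestrict g), hc.Icc_extend',
    fun s hs => IccExtend_of_mem h _ hs⟩

theorem uIcc_zero_subset {s t : ℝ} (hs : s ∈ uIcc 0 t) : uIcc 0 s ⊆ uIcc 0 t :=
  uIcc_subset_uIcc_left hs

theorem norm_integral_le_of_le_mul_norm_add [CompleteSpace E] {g : ℝ → E} (hg : Continuous g)
    {K δ t : ℝ} (ht : 0 ≤ t)
    (h : ∀ s ∈ Icc 0 t, ‖g s‖ ≤ K * ‖∫ r in (0 : ℝ)..s, g r‖ + K * δ) :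
    ‖∫ r in (0 : ℝ)..t, g r‖ ≤ δ * Real.exp (K * t) - δ := by
  have hd : ∀ s, HasDerivAt (fun s => ∫ r in (0 : ℝ)..s, g r) (g s) s := fun s =>
    (hg.integral_hasStrictDerivAt 0 s).hasDerivAt
  have := norm_le_gronwallBound_of_norm_deriv_right_le
    (f := fun s => ∫ r in (0 : ℝ)..s, g r) (f' := g) (δ := 0) (K := K) (ε := K * δ)
    (a := 0) (b := t) (fun s _ => (hd s).continuousAt.continuousWithinAt)
    (fun s _ => (hd s).hasDerivWithinAt) (by simp) (fun s hs => h s (Ico_subset_Icc_self hs)) t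
    ⟨ht, le_rfl⟩
  refine this.trans_eq ?_
  rw [sub_zero]
  -- `gronwallBound` is defined by cases, but for `ε = K δ` one formula covers both.
  by_cases hK : K = 0
  · rw [hK, gronwallBound_K0]
    simp
  · rw [gronwallBound_of_K_ne_0 hK]
    field_simp
    ring

/-- Grönwall's inequality in integral form, forward and backward in time. Here `e` is a
perturbation which is small itself, while its derivative, if it exists, need not be. -/
theorem norm_sub_le_mul_exp [CompleteSpace E] {x y e g : ℝ → E} {K δ t : ℝ} (hK : 0 ≤ K)
    (hg : ContinuousOn g (uIcc 0 t))
    (hxy : ∀ s ∈ uIcc 0 t, x s - y s = e s + ∫ r in (0 : ℝ)..s, g r)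
    (he : ∀ s ∈ uIcc 0 t, ‖e s‖ ≤ δ)
    (hgK : ∀ s ∈ uIcc 0 t, ‖g s‖ ≤ K * ‖x s - y s‖) :
    ‖x t - y t‖ ≤ δ * Real.exp (K * |t|) := by
  obtain ⟨g', hg', hgg'⟩ := exists_continuous_eqOn_uIcc hg
  have hint : ∀ s ∈ uIcc 0 t, ∫ r in (0 : ℝ)..s, g r = ∫ r in (0 : ℝ)..s, g' r := fun s hs =>
    intervalIntegral.integral_congr fun r hr => (hgg' (uIcc_zero_subset hs hr)).symm
  have hb : ∀ s ∈ uIcc 0 t, ‖g' s‖ ≤ K * ‖∫ r in (0 : ℝ)..s, g' r‖ + K * δ := by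
    intro s hs
    rw [hgg' hs]
    refine (hgK s hs).trans ?_
    rw [hxy s hs, hint s hs, ← mul_add, add_comm ‖∫ r in (0 : ℝ)..s, g' r‖]
    gcongr
    exact (norm_add_le _ _).trans (by gcongr; exact he s hs)
  have key : ‖∫ r in (0 : ℝ)..t, g' r‖ ≤ δ * Real.exp (K * |t|) - δ := by
    rcases le_total 0 t with ht | ht
    · rw [abs_of_nonneg ht]
      rw [uIcc_of_le ht] at hb
      exact norm_integral_le_of_le_mul_norm_add hg' ht hb
    · rw [abs_of_nonpos ht]
      have hneg : ∀ s, ∫ r in (0 : ℝ)..s, g' (-r) = -∫ r in (0 : ℝ)..(-s), g' r := by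
        intro s
        rw [intervalIntegral.integral_comp_neg, neg_zero, intervalIntegral.integral_symm]
      have := norm_integral_le_of_le_mul_norm_add (g := fun r => g' (-r)) (K := K) (δ := δ)
        (hg'.comp continuous_neg) (neg_nonneg.mpr ht) fun s hs => by
          rw [hneg, norm_neg]
          refine hb (-s) ?_
          rw [uIcc_of_ge ht]
          exact ⟨by linarith [hs.2], by linarith [hs.1]⟩
      rwa [hneg, norm_neg, neg_neg] at this
  rw [hxy t right_mem_uIcc, hint t right_mem_uIcc]
  linarith [norm_add_le (e t) (∫ r in (0 : ℝ)..t, g' r), he t right_mem_uIcc]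

/-! ### Radial truncation -/

/-- The radial retraction of a normed space onto the closed ball of radius `R > 0`. -/
def ballRetract (R : ℝ) (x : E) : E := (R / max R ‖x‖) • x

theorem ballRetract_of_norm_le {R : ℝ} (hR : 0 < R) {x : E} (hx : ‖x‖ ≤ R) :
    ballRetract R x = x := by
  rw [ballRetract, max_eq_left hx, div_self hR.ne', one_smul]

theorem norm_ballRetract_le {R : ℝ} (hR : 0 < R) (x : E) : ‖ballRetract R x‖ ≤ R := by
  have hm : 0 < max R ‖x‖ := lt_max_of_lt_left hR
  rw [ballRetract, norm_smul, Real.norm_of_nonneg (by positivity), div_mul_eq_mul_div,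
    div_le_iff₀ hm]
  gcongr
  exact le_max_right _ _

theorem norm_ballRetract_sub_le {R : ℝ} (hR : 0 < R) (x y : E) :
    ‖ballRetract R x - ballRetract R y‖ ≤ 2 * ‖x - y‖ := by
  have hx : 0 < max R ‖x‖ := lt_max_of_lt_left hR
  have hy : 0 < max R ‖y‖ := lt_max_of_lt_left hR
  have e : ballRetract R x - ballRetract R y =
      (R / max R ‖x‖) • (x - y) + (R / max R ‖x‖ - R / max R ‖y‖) • y := by
    simp only [ballRetract, smul_sub, sub_smul]
    abel
  have h1 : ‖(R / max R ‖x‖) • (x - y)‖ ≤ ‖x - y‖ := by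
    rw [norm_smul, Real.norm_of_nonneg (by positivity)]
    exact mul_le_of_le_one_left (norm_nonneg _) ((div_le_one hx).mpr (le_max_left _ _))
  have h2 : ‖(R / max R ‖x‖ - R / max R ‖y‖) • y‖ ≤ ‖x - y‖ := by
    have e2 : R / max R ‖x‖ - R / max R ‖y‖ =
        R / max R ‖x‖ * ((max R ‖y‖ - max R ‖x‖) / max R ‖y‖) := by
      field_simp
    rw [norm_smul, e2, norm_mul, Real.norm_of_nonneg (by positivity : 0 ≤ R / max R ‖x‖),
      norm_div, Real.norm_of_nonneg hy.le, Real.norm_eq_abs, mul_assoc,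
      div_mul_eq_mul_div |max R ‖y‖ - max R ‖x‖|]
    have h3 : |max R ‖y‖ - max R ‖x‖| ≤ ‖x - y‖ := by
      refine (abs_max_sub_max_le_max R ‖y‖ R ‖x‖).trans ?_
      rw [sub_self, abs_zero, max_eq_right (abs_nonneg _), norm_sub_rev]
      exact abs_norm_sub_norm_le y x
    have h4 : |max R ‖y‖ - max R ‖x‖| * ‖y‖ / max R ‖y‖ ≤ ‖x - y‖ := by
      rw [div_le_iff₀ hy]
      gcongr
      exact le_max_right _ _
    refine (mul_le_of_le_one_left (by positivity) ?_).trans h4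
    exact (div_le_one hx).mpr (le_max_left _ _)
  rw [e, two_mul]
  exact (norm_add_le _ _).trans (add_le_add h1 h2)

/-! ### Existence and uniqueness for semilinear integral equations -/

/-- A continuous time-dependent vector field vanishing at the origin which is Lipschitz on balls,
uniformly in time. -/
structure IsAdmissible (F : ℝ → E → E) : Prop where
  continuous : Continuous (Function.uncurry F)
  map_zero : ∀ t, F t 0 = 0
  lipschitz : ∀ R : ℝ, ∃ L : ℝ, 0 ≤ L ∧
    ∀ t x y, ‖x‖ ≤ R → ‖y‖ ≤ R → ‖F t x - F t y‖ ≤ L * ‖x - y‖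

/-- `y` solves `y' = F(t, y)`, `y(0) = x₀` on `J`, in integral form. -/
def IsIntegralSolution (F : ℝ → E → E) (x₀ : E) (J : Set ℝ) (y : ℝ → E) : Prop :=
  ContinuousOn y J ∧ ∀ t ∈ J, y t = x₀ + ∫ s in (0 : ℝ)..t, F s (y s)

theorem IsIntegralSolution.mono {F : ℝ → E → E} {x₀ : E} {J J' : Set ℝ} {y : ℝ → E}
    (h : IsIntegralSolution F x₀ J y) (hJ : J' ⊆ J) : IsIntegralSolution F x₀ J' y :=
  ⟨h.1.mono hJ, fun t ht => h.2 t (hJ ht)⟩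

theorem IsAdmissible.continuousOn_comp {E : Type*} [NormedAddCommGroup E] {F : ℝ → E → E} (hF : IsAdmissible F) {y : ℝ → E}
    {J : Set ℝ} (hy : ContinuousOn y J) : ContinuousOn (fun s => F s (y s)) J :=
  hF.continuous.comp_continuousOn (continuousOn_id.prodMk hy)

theorem IsIntegralSolution.eqOn [CompleteSpace E] {F : ℝ → E → E} (hF : IsAdmissible F) {x₀ : E}
    {J : Set ℝ} (hJ : J.OrdConnected) (h0 : (0 : ℝ) ∈ J) {x y : ℝ → E}
    (hx : IsIntegralSolution F x₀ J x) (hy : IsIntegralSolution F x₀ J y) : EqOn x y J := by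
  intro t ht
  have hsub := hJ.uIcc_subset h0 ht
  obtain ⟨R, hR⟩ := isCompact_uIcc.exists_bound_of_continuousOn (hx.1.mono hsub)
  obtain ⟨R', hR'⟩ := isCompact_uIcc.exists_bound_of_continuousOn (hy.1.mono hsub)
  obtain ⟨L, hL0, hL⟩ := hF.lipschitz (max R R')
  have hcx := (hF.continuousOn_comp hx.1).mono hsub
  have hcy := (hF.continuousOn_comp hy.1).mono hsub
  have := norm_sub_le_mul_exp (x := x) (y := y) (e := fun _ => 0) (δ := 0) (t := t) hL0
    (hcx.sub hcy) (fun s hs => by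
      have hs' := uIcc_zero_subset hs
      rw [hx.2 s (hsub hs), hy.2 s (hsub hs), add_sub_add_left_eq_sub, zero_add,
        ← intervalIntegral.integral_sub (hcx.mono hs').intervalIntegrable
          (hcy.mono hs').intervalIntegrable]
      rfl) (by simp)
    (fun s hs => hL s _ _ ((hR s hs).trans (le_max_left _ _)) ((hR' s hs).trans (le_max_right _ _)))
  rw [zero_mul] at this
  exact sub_eq_zero.mp (norm_le_zero_iff.mp this)

/-- The truncated equation has solutions on every compact time interval. -/
theorem exists_truncated_solution [CompleteSpace E] {F : ℝ → E → E} (hF : IsAdmissible F) (x₀ : E)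
    {R : ℝ} (hR : 0 < R) {M : ℝ} (hM : 0 ≤ M) :
    ∃ y, IsIntegralSolution (fun t x => F t (ballRetract R x)) x₀ (Icc (-M) M) y := by
  obtain ⟨L, hL0, hL⟩ := hF.lipschitz R
  let K : NNReal := ⟨L * 2, by positivity⟩
  let B : NNReal := ⟨L * R, by positivity⟩
  let M' : NNReal := ⟨M, hM⟩
  have hLip : ∀ t x y, ‖F t (ballRetract R x) - F t (ballRetract R y)‖ ≤ L * 2 * ‖x - y‖ := by
    intro t x y
    refine (hL t _ _ (norm_ballRetract_le hR x) (norm_ballRetract_le hR y)).trans ?_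
    rw [mul_assoc]
    gcongr
    exact norm_ballRetract_sub_le hR x y
  have h : IsPicardLindelof (fun t x => F t (ballRetract R x)) (tmin := -M) (tmax := M)
      ⟨0, by constructor <;> linarith⟩ x₀ (B * M') 0 B K := by
    refine ⟨fun t _ => ?_, fun x _ => ?_, fun t _ x _ => ?_, ?_⟩
    · refine LipschitzWith.lipschitzOnWith (LipschitzWith.of_dist_le_mul fun x y => ?_)
      rw [dist_eq_norm, dist_eq_norm]
      exact hLip t x y
    · exact (hF.continuous.comp (continuous_id.prodMk continuous_const)).continuousOn
    · have := hL t (ballRetract R x) 0 (norm_ballRetract_le hR x) (by simpa using hR.le)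
      rw [hF.map_zero, sub_zero, sub_zero] at this
      exact this.trans (mul_le_mul_of_nonneg_left (norm_ballRetract_le hR x) hL0)
    · change L * R * max (M - 0) (0 - -M) ≤ L * R * M - 0
      simp
  -- The field is bounded by `L R`, so the ball of radius `L R M` admits the whole interval `[-M, M]`.
  obtain ⟨γ, hγ⟩ := ODE.FunSpace.exists_isFixedPt_next h (Metric.mem_closedBall_self le_rfl)
  refine ⟨γ.compProj, γ.continuous_compProj.continuousOn, fun t ht => ?_⟩
  rw [ODE.FunSpace.compProj_of_mem ht]
  exact (ODE.FunSpace.isFixedPt_next_iff h _).mp hγ ⟨t, ht⟩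

theorem IsIntegralSolution.of_truncated {F : ℝ → E → E} {x₀ : E} {R : ℝ} (hR : 0 < R)
    {J : Set ℝ} (hJ : J.OrdConnected) (h0 : (0 : ℝ) ∈ J) {y : ℝ → E}
    (h : IsIntegralSolution (fun t x => F t (ballRetract R x)) x₀ J y)
    (hy : ∀ t ∈ J, ‖y t‖ ≤ R) : IsIntegralSolution F x₀ J y := by
  refine ⟨h.1, fun t ht => ?_⟩
  rw [h.2 t ht]
  congr 1
  refine intervalIntegral.integral_congr fun s hs => ?_
  simp only [ballRetract_of_norm_le hR (hy s (hJ.uIcc_subset h0 ht hs))]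

theorem exists_local_solution [CompleteSpace E] {F : ℝ → E → E} (hF : IsAdmissible F) (x₀ : E) :
    ∃ δ > 0, ∃ y, IsIntegralSolution F x₀ (Ioo (-δ) δ) y := by
  have hR : 0 < ‖x₀‖ + 1 := by positivity
  obtain ⟨y, hy⟩ := exists_truncated_solution hF x₀ hR zero_le_one
  have h0 : y 0 = x₀ := by
    rw [hy.2 0 (by norm_num), intervalIntegral.integral_same, add_zero]
  have hc : ContinuousAt y 0 := hy.1.continuousAt (Icc_mem_nhds (by norm_num) (by norm_num))
  have hev : ∀ᶠ t in 𝓝 (0 : ℝ), ‖y t‖ ≤ ‖x₀‖ + 1 := by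
    refine hc.norm.eventually (eventually_le_nhds ?_)
    simpa only [h0] using lt_add_one ‖x₀‖
  obtain ⟨δ, hδ, hball⟩ := Metric.eventually_nhds_iff.mp hev
  have hpos : 0 < min δ 1 := lt_min hδ one_pos
  refine ⟨min δ 1, hpos, y, ?_⟩
  refine (hy.mono fun t ht => ?_).of_truncated hR ordConnected_Ioo ⟨by linarith, hpos⟩
    fun t ht => ?_
  · exact ⟨by linarith [ht.1, min_le_right δ 1], by linarith [ht.2, min_le_right δ 1]⟩
  · refine hball ?_
    rw [Real.dist_eq, sub_zero]
    exact (abs_lt.mpr ht).trans_le (min_le_left _ _)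

end ODE

/-! ### Averaging of rapidly oscillating vector fields -/

section Averaging

variable {E : Type*} [NormedAddCommGroup E]

/-- A continuous function which is periodic in the second variable is uniformly continuous in the
first one, locally in the first and globally in the second. -/
theorem exists_delta_of_periodic {k : ℝ → ℝ → E} (hk : Continuous (Function.uncurry k)) {P : ℝ}
    (hP : 0 < P) (hper : ∀ s, Function.Periodic (k s) P) (M : ℝ) {η : ℝ} (hη : 0 < η) :
    ∃ r > 0, ∀ s s', |s| ≤ M → |s'| ≤ M → |s - s'| < r → ∀ τ, ‖k s τ - k s' τ‖ ≤ η := by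
  have hcomp : IsCompact (Icc (-M) M ×ˢ Icc 0 P) := isCompact_Icc.prod isCompact_Icc
  have huc := hcomp.uniformContinuousOn_of_continuous hk.continuousOn
  obtain ⟨r, hr, h⟩ := Metric.uniformContinuousOn_iff.mp huc η hη
  refine ⟨r, hr, fun s s' hs hs' hss τ => ?_⟩
  obtain ⟨n, hn⟩ : ∃ n : ℤ, τ - n • P ∈ Ico 0 P :=
    ⟨toIcoDiv hP 0 τ, by simpa using sub_toIcoDiv_zsmul_mem_Ico hP 0 τ⟩
  have e : ∀ u, k u τ = k u (τ - n • P) := fun u => ((hper u).sub_zsmul_eq n).symm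
  rw [e s, e s', ← dist_eq_norm]
  refine (h (s, τ - n • P) ⟨abs_le.mp hs, Ico_subset_Icc_self hn⟩ (s', τ - n • P)
    ⟨abs_le.mp hs', Ico_subset_Icc_self hn⟩ ?_).le
  rw [Prod.dist_eq, dist_self, Real.dist_eq]
  exact max_lt hss hr

theorem exists_bound_of_periodic {k : ℝ → ℝ → E} (hk : Continuous (Function.uncurry k)) {P : ℝ}
    (hP : 0 < P) (hper : ∀ s, Function.Periodic (k s) P) (M : ℝ) :
    ∃ C, 0 ≤ C ∧ ∀ s, |s| ≤ M → ∀ τ, ‖k s τ‖ ≤ C := by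
  have hcomp : IsCompact (Icc (-M) M ×ˢ Icc 0 P) := isCompact_Icc.prod isCompact_Icc
  obtain ⟨C, hC⟩ := hcomp.exists_bound_of_continuousOn hk.continuousOn
  refine ⟨max C 0, le_max_right _ _, fun s hs τ => ?_⟩
  obtain ⟨n, hn⟩ : ∃ n : ℤ, τ - n • P ∈ Ico 0 P :=
    ⟨toIcoDiv hP 0 τ, by simpa using sub_toIcoDiv_zsmul_mem_Ico hP 0 τ⟩
  rw [← (hper s).sub_zsmul_eq n]
  exact (hC (s, τ - n • P) ⟨abs_le.mp hs, Ico_subset_Icc_self hn⟩).trans (le_max_left _ _)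

variable [NormedSpace ℝ E]

/-- The mean over a period `P` of the second variable. -/
def periodMean (P : ℝ) (k : ℝ → ℝ → E) (s : ℝ) : E := P⁻¹ • ∫ τ in (0 : ℝ)..P, k s τ

theorem continuous_periodMean {k : ℝ → ℝ → E} (hk : Continuous (Function.uncurry k)) (P : ℝ) :
    Continuous (periodMean P k) :=
  (intervalIntegral.continuous_parametric_intervalIntegral_of_continuous' hk 0 P).const_smul _

theorem intervalIntegral_swap_of_continuous {h : ℝ → ℝ → E} (hh : Continuous (Function.uncurry h))
    (a b c d : ℝ) :
    ∫ s in a..b, ∫ τ in c..d, h s τ = ∫ τ in c..d, ∫ s in a..b, h s τ :=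
  intervalIntegral_intervalIntegral_swap <|
    (hh.continuousOn.integrableOn_compact (isCompact_uIcc.prod isCompact_uIcc)).mono_set
      (prod_mono uIoc_subset_uIcc uIoc_subset_uIcc)

/-- The rapidly oscillating function `s ↦ k s (s / ε)` and its mean have almost the same
primitives. The mean at `s` is the mean of `k s ((s + σ) / ε)` over `σ ∈ [0, εP]`. Replacing the
slow variable `s` by `s + σ` turns this into a mean of translates of `k s (s / ε)`, and a
translation by `σ` changes the primitive of a bounded function by `O(σ)`. -/
theorem eventually_norm_integral_sub_periodMean_le [CompleteSpace E] {k : ℝ → ℝ → E}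
    (hk : Continuous (Function.uncurry k)) {P : ℝ} (hP : 0 < P)
    (hper : ∀ s, Function.Periodic (k s) P) {M : ℝ} (hM : 0 ≤ M) {δ : ℝ} (hδ : 0 < δ) :
    ∀ᶠ ε in 𝓝[>] (0 : ℝ), ∀ t, |t| ≤ M →
      ‖∫ s in (0 : ℝ)..t, (k s (s / ε) - periodMean P k s)‖ ≤ δ := by
  obtain ⟨C, hC0, hC⟩ := exists_bound_of_periodic hk hP hper (M + 1)
  obtain ⟨r, hr, hω⟩ := exists_delta_of_periodic hk hP hper (M + 1)
    (η := δ / (2 * (M + 1))) (by positivity)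
  set η := δ / (2 * (M + 1)) with hη
  set r' := min (min (r / 2) 1) (δ / (4 * (C + 1))) with hr'
  have hr'0 : 0 < r' := by positivity
  have hev : ∀ᶠ ε in 𝓝[>] (0 : ℝ), ε < r' / P :=
    nhdsWithin_le_nhds (eventually_lt_nhds (by positivity))
  filter_upwards [hev, self_mem_nhdsWithin] with ε hε hε0 t ht
  have hε0' : (0 : ℝ) < ε := hε0
  have hεP : ε * P < r' := (lt_div_iff₀ hP).mp hε
  set g : ℝ → E := fun s => k s (s / ε) with hg
  have hgc : Continuous g := hk.comp (continuous_id.prodMk (continuous_id.div_const ε))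
  have hshift : ∀ τ, Continuous fun s => k s (s / ε + τ) := fun τ =>
    hk.comp (continuous_id.prodMk ((continuous_id.div_const ε).add continuous_const))
  have hmean : ∀ s, P • (periodMean P k s - g s) = ∫ τ in (0 : ℝ)..P, (k s (s / ε + τ) - g s) := by
    intro s
    have hks : Continuous (k s) := hk.comp (continuous_const.prodMk continuous_id)
    have e1 : ∫ τ in (0 : ℝ)..P, k s (s / ε + τ) = ∫ τ in (0 : ℝ)..P, k s τ := by
      rw [intervalIntegral.integral_comp_add_left (k s) (s / ε), add_zero,
        (hper s).intervalIntegral_add_eq (s / ε) 0, zero_add]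
    have hks' : Continuous fun τ => k s (s / ε + τ) := hks.comp (by fun_prop)
    rw [intervalIntegral.integral_sub (hks'.intervalIntegrable _ _)
      (continuous_const.intervalIntegrable _ _), e1, intervalIntegral.integral_const, sub_zero,
      smul_sub, periodMean, smul_inv_smul₀ hP.ne']
  have hslice : ∀ τ ∈ uIoc 0 P, ‖∫ s in (0 : ℝ)..t, (k s (s / ε + τ) - g s)‖ ≤ δ := by
    intro τ hτ
    rw [uIoc_of_le hP.le] at hτ
    set σ := ε * τ with hσ
    have hσ0 : 0 ≤ σ := mul_nonneg hε0'.le hτ.1.le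
    have hσr : σ < r' := (mul_le_mul_of_nonneg_left hτ.2 hε0'.le).trans_lt hεP
    have hσ1 : σ < 1 := hσr.trans_le ((min_le_left _ _).trans (min_le_right _ _))
    have hσ2 : σ < r := by
      have := (hσr.trans_le ((min_le_left _ _).trans (min_le_left _ _)))
      linarith
    have hσ3 : σ ≤ δ / (4 * (C + 1)) := hσr.le.trans (min_le_right _ _)
    have hgσ : Continuous fun s => g (s + σ) := hgc.comp (by fun_prop)
    have hst : ∀ s ∈ uIoc 0 t, |s| ≤ M := by
      intro s hs
      have hs' := uIoc_subset_uIcc hs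
      have h1 := abs_sub_left_of_mem_uIcc hs'
      rw [sub_zero, sub_zero] at h1
      exact h1.trans ht
    have b1 : ‖∫ s in (0 : ℝ)..t, (k s (s / ε + τ) - g (s + σ))‖ ≤ δ / 2 := by
      have : ‖∫ s in (0 : ℝ)..t, (k s (s / ε + τ) - g (s + σ))‖ ≤ η * |t - 0| := by
        refine intervalIntegral.norm_integral_le_of_norm_le_const fun s hs => ?_
        have hs1 := hst s hs
        have e : (s + σ) / ε = s / ε + τ := by
          rw [hσ]
          field_simp
        rw [hg]
        simp only
        rw [e]
        refine hω s (s + σ) (by linarith) ?_ ?_ _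
        · exact (abs_add_le _ _).trans (by rw [abs_of_nonneg hσ0]; linarith)
        · rw [sub_add_cancel_left, abs_neg, abs_of_nonneg hσ0]
          exact hσ2
      refine this.trans ?_
      rw [sub_zero, hη, div_mul_eq_mul_div, div_le_div_iff₀ (by positivity) two_pos]
      nlinarith
    have hgb : ∀ s, |s| ≤ M + 1 → ‖g s‖ ≤ C := fun s hs => hC s hs _
    have b2 : ‖∫ s in (0 : ℝ)..t, (g (s + σ) - g s)‖ ≤ δ / 2 := by
      have hgi : ∀ a b, IntervalIntegrable g volume a b := fun a b => hgc.intervalIntegrable a b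
      have e : ∫ s in (0 : ℝ)..t, (g (s + σ) - g s) =
          (∫ s in t..(t + σ), g s) - ∫ s in (0 : ℝ)..σ, g s := by
        rw [intervalIntegral.integral_sub (hgσ.intervalIntegrable _ _) (hgi _ _),
          intervalIntegral.integral_comp_add_right g σ, zero_add,
          intervalIntegral.integral_interval_sub_interval_comm' (hgi _ _) (hgi _ _) (hgi _ _)]
      rw [e]
      have h1 : ‖∫ s in t..(t + σ), g s‖ ≤ C * |t + σ - t| := by
        refine intervalIntegral.norm_integral_le_of_norm_le_const fun s hs => hgb s ?_
        rw [uIoc_of_le (by linarith)] at hs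
        have := abs_le.mp ht
        exact abs_le.mpr ⟨by linarith [hs.1], by linarith [hs.2]⟩
      have h2 : ‖∫ s in (0 : ℝ)..σ, g s‖ ≤ C * |σ - 0| := by
        refine intervalIntegral.norm_integral_le_of_norm_le_const fun s hs => hgb s ?_
        rw [uIoc_of_le hσ0] at hs
        exact abs_le.mpr ⟨by linarith [hs.1], by linarith [hs.2]⟩
      rw [add_sub_cancel_left, abs_of_nonneg hσ0] at h1
      rw [sub_zero, abs_of_nonneg hσ0] at h2
      have h3 : C * σ ≤ δ / 4 := by
        have h4 : C * σ ≤ (C + 1) * (δ / (4 * (C + 1))) := by gcongr; linarith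
        have h5 : (C + 1) * (δ / (4 * (C + 1))) = δ / 4 := by field_simp
        linarith
      linarith [norm_sub_le (∫ s in t..(t + σ), g s) (∫ s in (0 : ℝ)..σ, g s)]
    have e : ∫ s in (0 : ℝ)..t, (k s (s / ε + τ) - g s) =
        (∫ s in (0 : ℝ)..t, (k s (s / ε + τ) - g (s + σ))) +
          ∫ s in (0 : ℝ)..t, (g (s + σ) - g s) := by
      have c1 : Continuous fun s => k s (s / ε + τ) - g (s + σ) := (hshift τ).sub hgσ
      have c2 : Continuous fun s => g (s + σ) - g s := hgσ.sub hgc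
      rw [← intervalIntegral.integral_add (c1.intervalIntegrable _ _) (c2.intervalIntegrable _ _)]
      simp
    rw [e]
    linarith [norm_add_le (∫ s in (0 : ℝ)..t, (k s (s / ε + τ) - g (s + σ)))
      (∫ s in (0 : ℝ)..t, (g (s + σ) - g s))]
  have hcont : Continuous (Function.uncurry fun s τ => k s (s / ε + τ) - g s) := by
    have h1 : Continuous fun p : ℝ × ℝ => k p.1 (p.1 / ε + p.2) :=
      hk.comp (continuous_fst.prodMk ((continuous_fst.div_const ε).add continuous_snd))
    exact h1.sub (hgc.comp continuous_fst)
  have hmain : P • ∫ s in (0 : ℝ)..t, (periodMean P k s - g s) =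
      ∫ τ in (0 : ℝ)..P, ∫ s in (0 : ℝ)..t, (k s (s / ε + τ) - g s) := by
    rw [← intervalIntegral_swap_of_continuous hcont, ← intervalIntegral.integral_smul]
    exact intervalIntegral.integral_congr fun s _ => hmean s
  have h1 : ‖P • ∫ s in (0 : ℝ)..t, (periodMean P k s - g s)‖ ≤ δ * |P - 0| := by
    rw [hmain]
    exact intervalIntegral.norm_integral_le_of_norm_le_const hslice
  rw [norm_smul, Real.norm_of_nonneg hP.le, sub_zero, abs_of_pos hP, mul_comm] at h1
  have h2 := le_of_mul_le_mul_right h1 hP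
  have e : ∫ s in (0 : ℝ)..t, (k s (s / ε) - periodMean P k s) =
      -∫ s in (0 : ℝ)..t, (periodMean P k s - g s) := by
    rw [← intervalIntegral.integral_neg]
    simp [hg]
  rwa [e, norm_neg]

/-- The averaging principle. Let `z` solve the averaged equation on `[-M, M]`. Then for small `ε`
the equation with the right-hand side `G s (s / ε)` has a solution on `[-M, M]` close to `z`. -/
theorem exists_solution_near_averaged [CompleteSpace E] {G : ℝ → ℝ → E → E}
    (hG : Continuous fun p : ℝ × ℝ × E => G p.1 p.2.1 p.2.2) {P : ℝ} (hP : 0 < P)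
    (hper : ∀ s x, Function.Periodic (fun τ => G s τ x) P) (hG0 : ∀ s τ, G s τ 0 = 0)
    (hlip : ∀ R : ℝ, ∃ L : ℝ, 0 ≤ L ∧
      ∀ s τ x y, ‖x‖ ≤ R → ‖y‖ ≤ R → ‖G s τ x - G s τ y‖ ≤ L * ‖x - y‖)
    {x₀ : E} {M : ℝ} (hM : 0 ≤ M) {z : ℝ → E}
    (hz : IsIntegralSolution (fun s x => periodMean P (fun s τ => G s τ x) s) x₀ (Icc (-M) M) z)
    {η : ℝ} (hη : 0 < η) :
    ∀ᶠ ε in 𝓝[>] (0 : ℝ), ∃ y : ℝ → E,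
      IsIntegralSolution (fun s => G s (s / ε)) x₀ (Icc (-M) M) y ∧
        ∀ t ∈ Icc (-M) M, ‖y t - z t‖ ≤ η := by
  have hMM : -M ≤ M := by linarith
  have h0M : (0 : ℝ) ∈ Icc (-M) M := ⟨by linarith, hM⟩
  obtain ⟨R₀, hR₀⟩ := isCompact_Icc.exists_bound_of_continuousOn hz.1
  obtain ⟨z', hz'c, hz'z⟩ := exists_continuous_eqOn_uIcc (a := -M) (b := M)
    (by rw [uIcc_of_le hMM]; exact hz.1)
  rw [uIcc_of_le hMM] at hz'z
  have hR₀0 : 0 ≤ R₀ := (norm_nonneg _).trans (hR₀ 0 h0M)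
  set R := R₀ + 1 with hR
  have hRpos : 0 < R := by positivity
  obtain ⟨L, hL0, hL⟩ := hlip R
  set k : ℝ → ℝ → E := fun s τ => G s τ (z' s) with hk
  have hkc : Continuous (Function.uncurry k) :=
    hG.comp (continuous_fst.prodMk (continuous_snd.prodMk (hz'c.comp continuous_fst)))
  set η' := min η 1 with hη'
  have hη'0 : 0 < η' := lt_min hη one_pos
  -- The truncated field has Lipschitz constant `2L`, so Grönwall's inequality turns `δ` into `η'`.
  set δ := η' * Real.exp (-(L * 2 * M)) with hδ
  have hδ0 : 0 < δ := by positivity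
  filter_upwards [eventually_norm_integral_sub_periodMean_le hkc hP (fun s => hper s (z' s)) hM hδ0]
    with ε hε
  have hGc : Continuous (Function.uncurry fun s => G s (s / ε)) :=
    hG.comp (continuous_fst.prodMk ((continuous_fst.div_const ε).prodMk continuous_snd))
  have hadm : IsAdmissible fun s => G s (s / ε) := by
    refine ⟨hGc, fun s => hG0 s _, fun R => ?_⟩
    obtain ⟨L, hL0, hL⟩ := hlip R
    exact ⟨L, hL0, fun s x y hx hy => hL s _ x y hx hy⟩
  obtain ⟨y, hy⟩ := exists_truncated_solution hadm x₀ hRpos hM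
  have hordc : (Icc (-M) M).OrdConnected := ordConnected_Icc
  have hyc : ContinuousOn (fun s => G s (s / ε) (ballRetract R (y s))) (Icc (-M) M) := by
    have hret : Continuous (ballRetract R : E → E) := by
      refine LipschitzWith.continuous (K := 2) (LipschitzWith.of_dist_le_mul fun a b => ?_)
      rw [dist_eq_norm, dist_eq_norm]
      exact norm_ballRetract_sub_le hRpos a b
    exact hGc.comp_continuousOn (continuousOn_id.prodMk (hret.comp_continuousOn hy.1))
  have hgc : Continuous fun s => k s (s / ε) :=
    hkc.comp (continuous_id.prodMk (continuous_id.div_const ε))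
  have hmc := continuous_periodMean hkc P
  have hclose : ∀ t ∈ Icc (-M) M, ‖y t - z t‖ ≤ η' := by
    intro t ht
    have hsub := hordc.uIcc_subset h0M ht
    have habs : |t| ≤ M := abs_le.mpr ht
    have := norm_sub_le_mul_exp (x := y) (y := z) (K := L * 2) (δ := δ) (t := t)
      (e := fun u => ∫ s in (0 : ℝ)..u, (k s (s / ε) - periodMean P k s))
      (g := fun s => G s (s / ε) (ballRetract R (y s)) - k s (s / ε)) (by positivity)
      ((hyc.mono hsub).sub hgc.continuousOn)
      (fun s hs => by
        have hs' : uIcc 0 s ⊆ Icc (-M) M := hordc.uIcc_subset h0M (hsub hs)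
        have hzint : z s = x₀ + ∫ r in (0 : ℝ)..s, periodMean P k r := by
          rw [hz.2 s (hsub hs)]
          congr 1
          refine intervalIntegral.integral_congr fun r hr => ?_
          simp only [periodMean, hk, hz'z (hs' hr)]
        rw [hy.2 s (hsub hs), hzint, add_sub_add_left_eq_sub,
          intervalIntegral.integral_sub (hgc.intervalIntegrable _ _) (hmc.intervalIntegrable _ _),
          intervalIntegral.integral_sub (hyc.mono hs').intervalIntegrable
            (hgc.intervalIntegrable _ _)]
        abel)
      (fun s hs => hε s (abs_le.mpr (hsub hs)))
      (fun s hs => by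
        have h1 : ‖z s‖ ≤ R := (hR₀ s (hsub hs)).trans (by linarith)
        have h2 : z' s = ballRetract R (z s) := by
          rw [ballRetract_of_norm_le hRpos h1, hz'z (hsub hs)]
        simp only [hk, h2]
        refine (hL s _ _ _ (norm_ballRetract_le hRpos _) (norm_ballRetract_le hRpos _)).trans ?_
        rw [mul_assoc]
        gcongr
        exact norm_ballRetract_sub_le hRpos _ _)
    refine this.trans ?_
    rw [hδ, mul_assoc, ← Real.exp_add]
    refine mul_le_of_le_one_right hη'0.le (Real.exp_le_one_iff.mpr ?_)
    have : L * 2 * |t| ≤ L * 2 * M := by gcongr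
    linarith
  refine ⟨y, hy.of_truncated hRpos hordc h0M fun t ht => ?_, fun t ht =>
    (hclose t ht).trans (min_le_left _ _)⟩
  have h1 := hclose t ht
  have h2 : η' ≤ 1 := min_le_right _ _
  have h3 := hR₀ t ht
  have h4 := norm_le_norm_add_norm_sub' (y t) (z t)
  linarith

end Averaging

/-! ### The interaction representation -/

/-- `T₁ t` as a continuous linear map. -/
def T₁CLM (t : ℝ) : H1 →L[ℂ] H1 := (T₁ₗᵢ t).toContinuousLinearMap

theorem T₁_neg_apply (t : ℝ) (f : H1) : T₁ (-t) (T₁ t f) = f := by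
  rw [← T₁_add, neg_add_cancel, T₁_zero]

theorem T₁_apply_neg (t : ℝ) (f : H1) : T₁ t (T₁ (-t) f) = f := by
  rw [← T₁_add, add_neg_cancel, T₁_zero]

/-- The vector field `w ↦ i T_s⁻¹ N(T_s w)`. In terms of `w = T_{-θ(t)} u` with `θ(t) = ∫₀ᵗ d`, the
equation `i∂ₜu + d(t)∂ₓ²u + N(u) = 0` reads `w' = i T_{θ(t)}⁻¹ N(T_{θ(t)} w)`. -/
def conjField (N : H1 → H1) (s : ℝ) (w : H1) : H1 := Complex.I • T₁ (-s) (N (T₁ s w))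

theorem _root_.ContinuousOn.T₁ {X : Type*} [TopologicalSpace X] {s : Set X} {a : X → ℝ} {f : X → H1}
    (ha : ContinuousOn a s) (hf : ContinuousOn f s) : ContinuousOn (fun x => T₁ (a x) (f x)) s := by
  have h := ContinuousOn.prodMk ha hf
  have h' := continuous_uncurry_T₁.comp_continuousOn h
  exact h'

theorem _root_.Continuous.T₁ {X : Type*} [TopologicalSpace X] {a : X → ℝ} {f : X → H1}
    (ha : Continuous a) (hf : Continuous f) : Continuous fun x => T₁ (a x) (f x) := by
  rw [← continuousOn_univ] at *
  exact ha.T₁ hf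

theorem continuous_conjField {N : H1 → H1} (hN : Continuous N) :
    Continuous (Function.uncurry (conjField N)) := by
  have h : Continuous fun p : ℝ × H1 => T₁ (-p.1) (N (T₁ p.1 p.2)) :=
    continuous_fst.neg.T₁ (hN.comp continuous_uncurry_T₁)
  exact h.const_smul Complex.I

theorem norm_conjField_sub (N : H1 → H1) (s : ℝ) (x y : H1) :
    ‖conjField N s x - conjField N s y‖ = ‖N (T₁ s x) - N (T₁ s y)‖ := by
  rw [conjField, conjField, ← smul_sub, ← T₁_sub_apply, norm_smul, Complex.norm_I, one_mul, norm_T₁]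

theorem conjField_zero {N : H1 → H1} (h0 : N 0 = 0) (s : ℝ) : conjField N s 0 = 0 := by
  rw [conjField, T₁_map_zero, h0, T₁_map_zero, smul_zero]

theorem LipschitzOnBalls.conjField {N : H1 → H1} (hN : LipschitzOnBalls N) (R : ℝ) :
    ∃ L : ℝ, 0 ≤ L ∧ ∀ s x y, ‖x‖ ≤ R → ‖y‖ ≤ R →
      ‖conjField N s x - conjField N s y‖ ≤ L * ‖x - y‖ := by
  obtain ⟨L, hL0, hL⟩ := hN R
  refine ⟨L, hL0, fun s x y hx hy => ?_⟩
  rw [norm_conjField_sub, ← norm_T₁ s (x - y), T₁_sub_apply]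
  exact hL _ _ (by rwa [norm_T₁]) (by rwa [norm_T₁])

theorem isAdmissible_conjField {N : H1 → H1} (hN : LipschitzOnBalls N) (h0 : N 0 = 0) {θ : ℝ → ℝ}
    (hθ : Continuous θ) : IsAdmissible fun t => conjField N (θ t) := by
  refine ⟨?_, fun t => conjField_zero h0 _, fun R => ?_⟩
  · have h1 : Continuous fun p : ℝ × H1 => (θ p.1, p.2) :=
      (hθ.comp continuous_fst).prodMk continuous_snd
    have h2 := (continuous_conjField hN.continuous).comp h1
    exact h2
  · obtain ⟨L, hL0, hL⟩ := hN.conjField R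
    exact ⟨L, hL0, fun t => hL (θ t)⟩

/-- Duhamel's formula in `L²(ℝ)` is the integral equation in `H¹(ℝ)` for `T_{-θ(t)} u(t)`. -/
theorem isSolutionOn_iff {d θ : ℝ → ℝ} {N : H1 → L2} {N₁ : H1 → H1} {φ : H1} {J : Set ℝ}
    {u : ℝ → H1} (hd : ∀ a b, IntervalIntegrable d volume a b)
    (hθ : ∀ t, ∫ r in (0 : ℝ)..t, d r = θ t) (hN : ∀ f, (N₁ f).toL2 = N f)
    (hN₁ : Continuous N₁) (hJ : J.OrdConnected) (h0 : (0 : ℝ) ∈ J) :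
    IsSolutionOn d N φ J u ↔
      IsIntegralSolution (fun t => conjField N₁ (θ t)) φ J fun t => T₁ (-θ t) (u t) := by
  have hθc : Continuous θ := by
    have := intervalIntegral.continuous_primitive hd 0
    simpa only [hθ] using this
  have hcont : ContinuousOn u J ↔ ContinuousOn (fun t => T₁ (-θ t) (u t)) J := by
    constructor
    · intro h
      exact hθc.neg.continuousOn.T₁ h
    · intro h
      have h' : ContinuousOn (fun t => T₁ (θ t) (T₁ (-θ t) (u t))) J :=
        hθc.continuousOn.T₁ h
      simpa only [T₁_apply_neg] using h'
  unfold IsSolutionOn IsIntegralSolution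
  rw [hcont]
  refine and_congr_right fun hc => forall₂_congr fun t ht => ?_
  set g : ℝ → H1 := fun s => conjField N₁ (θ s) (T₁ (-θ s) (u s)) with hg
  have hgc : ContinuousOn g J := by
    have h1 := ContinuousOn.prodMk (hθc.continuousOn (s := J)) hc
    have h2 := (continuous_conjField hN₁).comp_continuousOn h1
    exact h2
  have hgi : IntervalIntegrable g volume 0 t :=
    (hgc.mono (hJ.uIcc_subset h0 ht)).intervalIntegrable
  have hdiff : ∀ s, ∫ r in s..t, d r = θ t + -θ s := by
    intro s
    rw [← hθ t, ← hθ s, ← sub_eq_add_neg, intervalIntegral.integral_interval_sub_left (hd _ _) (hd _ _)]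
  have key : (T₁ (θ t) (φ + ∫ s in (0 : ℝ)..t, g s)).toL2 =
      T (∫ r in (0 : ℝ)..t, d r) φ.toL2 +
        Complex.I • ∫ s in (0 : ℝ)..t, T (∫ r in s..t, d r) (N (u s)) := by
    have h1 : (T₁ (θ t) (φ + ∫ s in (0 : ℝ)..t, g s)).toL2 = T (θ t) φ.toL2 +
        (H1.toL2CLM.comp (T₁CLM (θ t))) (∫ s in (0 : ℝ)..t, g s) :=
      (T (θ t)).map_add _ _
    rw [h1, hθ, ← ContinuousLinearMap.intervalIntegral_comp_comm _ hgi,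
      ← intervalIntegral.integral_smul]
    congr 1
    refine intervalIntegral.integral_congr fun s _ => ?_
    have h2 : g s = Complex.I • T₁ (-θ s) (N₁ (u s)) := by
      rw [hg]
      simp only [conjField, T₁_apply_neg]
    change (T₁ (θ t) (g s)).toL2 = Complex.I • T (∫ r in s..t, d r) (N (u s))
    rw [h2, T₁_smul, hdiff, T_add, ← hN]
    rfl
  rw [← key]
  constructor
  · intro h
    simp only [H1.toL2_injective h, T₁_neg_apply, hg]
  · intro h
    have h' : T₁ (θ t) (T₁ (-θ t) (u t)) = T₁ (θ t) (φ + ∫ s in (0 : ℝ)..t, g s) :=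
      congrArg (T₁ (θ t)) h
    rw [T₁_apply_neg] at h'
    rw [← h']

/-! ### Maximal solutions -/

/-- Local existence, and uniqueness on every interval containing the initial time. -/
def IsLocallyWellPosed (d : ℝ → ℝ) (N : H1 → L2) (φ : H1) : Prop :=
  (∃ δ > 0, ∃ u, IsSolutionOn d N φ (Ioo (-δ) δ) u) ∧
    ∀ J : Set ℝ, J.OrdConnected → (0 : ℝ) ∈ J → ∀ u w, IsSolutionOn d N φ J u →
      IsSolutionOn d N φ J w → EqOn u w J

theorem isLocallyWellPosed_of_lipschitz {d θ : ℝ → ℝ} {N : H1 → L2} {N₁ : H1 → H1} (φ : H1)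
    (hd : ∀ a b, IntervalIntegrable d volume a b)
    (hθ : ∀ t, ∫ r in (0 : ℝ)..t, d r = θ t) (hN : ∀ f, (N₁ f).toL2 = N f)
    (hN₁ : LipschitzOnBalls N₁) (hz : N₁ 0 = 0) : IsLocallyWellPosed d N φ := by
  have hθc : Continuous θ := by
    have := intervalIntegral.continuous_primitive hd 0
    simpa only [hθ] using this
  have hadm := isAdmissible_conjField hN₁ hz hθc
  constructor
  · obtain ⟨δ, hδ, y, hy⟩ := exists_local_solution hadm φ
    refine ⟨δ, hδ, fun t => T₁ (θ t) (y t), ?_⟩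
    rw [isSolutionOn_iff hd hθ hN hN₁.continuous ordConnected_Ioo ⟨by linarith, hδ⟩]
    simpa only [T₁_neg_apply] using hy
  · intro J hJ h0 u w hu hw t ht
    rw [isSolutionOn_iff hd hθ hN hN₁.continuous hJ h0] at hu hw
    have h := congrArg (T₁ (θ t)) (hu.eqOn hadm hJ h0 hw ht)
    simpa only [T₁_apply_neg] using h

theorem IsSolutionOn.mono {d : ℝ → ℝ} {N : H1 → L2} {φ : H1} {J J' : Set ℝ} {u : ℝ → H1}
    (h : IsSolutionOn d N φ J u) (hJ : J' ⊆ J) : IsSolutionOn d N φ J' u :=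
  ⟨h.1.mono hJ, fun t ht => h.2 t (hJ ht)⟩

theorem ordConnected_lifespan (S S' : EReal) : (lifespan S S').OrdConnected :=
  ⟨fun _ hx _ hy _ hz => ⟨hx.1.trans_le (EReal.coe_le_coe_iff.mpr hz.1),
    (EReal.coe_le_coe_iff.mpr hz.2).trans_lt hy.2⟩⟩

theorem zero_mem_lifespan {S S' : EReal} (hS : 0 < S) (hS' : 0 < S') : (0 : ℝ) ∈ lifespan S S' := by
  refine ⟨?_, by simpa using hS'⟩
  rw [EReal.coe_zero, EReal.neg_lt_comm, neg_zero]
  exact hS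

theorem exists_Ioo_subset_lifespan {S S' : EReal} (hS : 0 < S) (hS' : 0 < S') {t : ℝ}
    (ht : t ∈ lifespan S S') :
    ∃ a b : ℝ, a < 0 ∧ 0 < b ∧ t ∈ Ioo a b ∧ Ioo a b ⊆ lifespan S S' := by
  have h0 := zero_mem_lifespan hS hS'
  have h1 : -S < ((min 0 t : ℝ) : EReal) := by
    rcases min_choice 0 t with h | h <;> rw [h]
    exacts [h0.1, ht.1]
  have h2 : ((max 0 t : ℝ) : EReal) < S' := by
    rcases max_choice 0 t with h | h <;> rw [h]
    exacts [h0.2, ht.2]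
  obtain ⟨a, ha, ha'⟩ := EReal.lt_iff_exists_real_btwn.mp h1
  obtain ⟨b, hb, hb'⟩ := EReal.lt_iff_exists_real_btwn.mp h2
  rw [EReal.coe_lt_coe_iff] at ha' hb
  refine ⟨a, b, ha'.trans_le (min_le_left _ _), (le_max_left _ _).trans_lt hb,
    ⟨ha'.trans_le (min_le_right _ _), (le_max_right _ _).trans_lt hb⟩, fun s hs => ?_⟩
  exact ⟨ha.trans (EReal.coe_lt_coe_iff.mpr hs.1), (EReal.coe_lt_coe_iff.mpr hs.2).trans hb'⟩

theorem le_of_lifespan_subset {R R' S S' : EReal} (hR : 0 < R) (hR' : 0 < R') (hS : 0 < S)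
    (hS' : 0 < S') (h : lifespan R R' ⊆ lifespan S S') : R ≤ S ∧ R' ≤ S' := by
  constructor
  · by_contra! hlt
    obtain ⟨x, hx, hx'⟩ := EReal.lt_iff_exists_real_btwn.mp hlt
    have hx0 : 0 < x := EReal.coe_pos.mp (hS.trans hx)
    have hmem : -x ∈ lifespan R R' := by
      refine ⟨?_, lt_of_le_of_lt ?_ hR'⟩
      · rw [EReal.coe_neg]
        exact EReal.neg_lt_neg_iff.mpr hx'
      · exact EReal.coe_nonpos.mpr (by linarith)
    have := (h hmem).1
    rw [EReal.coe_neg, EReal.neg_lt_neg_iff] at this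
    exact lt_asymm hx this
  · by_contra! hlt
    obtain ⟨x, hx, hx'⟩ := EReal.lt_iff_exists_real_btwn.mp hlt
    have hmem : x ∈ lifespan R R' := by
      refine ⟨lt_of_lt_of_le ?_ (hS'.trans hx).le, hx'⟩
      rwa [EReal.neg_lt_comm, neg_zero]
    exact lt_asymm hx (h hmem).2

/-- Every open interval containing `0` is of the form `(-S, S')`. -/
theorem exists_eq_lifespan {A : Set ℝ} (hA : IsOpen A) (hA' : A.OrdConnected) (h0 : (0 : ℝ) ∈ A) :
    ∃ S S' : EReal, 0 < S ∧ 0 < S' ∧ lifespan S S' = A := by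
  have hright : ∀ t ∈ A, ∃ s ∈ A, t < s := fun t ht => by
    have h1 : ∀ᶠ s in 𝓝[>] t, s ∈ A := nhdsWithin_le_nhds (hA.mem_nhds ht)
    exact (h1.and self_mem_nhdsWithin).exists
  have hleft : ∀ t ∈ A, ∃ s ∈ A, s < t := fun t ht => by
    have h1 : ∀ᶠ s in 𝓝[<] t, s ∈ A := nhdsWithin_le_nhds (hA.mem_nhds ht)
    exact (h1.and self_mem_nhdsWithin).exists
  set I : EReal := sInf ((fun t : ℝ => (t : EReal)) '' A) with hI
  set S' : EReal := sSup ((fun t : ℝ => (t : EReal)) '' A) with hS'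
  have hIlt : ∀ t ∈ A, I < t := fun t ht => by
    obtain ⟨s, hs, hst⟩ := hleft t ht
    exact (sInf_le (mem_image_of_mem _ hs)).trans_lt (EReal.coe_lt_coe_iff.mpr hst)
  have hltS : ∀ t ∈ A, (t : EReal) < S' := fun t ht => by
    obtain ⟨s, hs, hst⟩ := hright t ht
    exact (EReal.coe_lt_coe_iff.mpr hst).trans_le (le_sSup (mem_image_of_mem _ hs))
  refine ⟨-I, S', ?_, by simpa using hltS 0 h0, Subset.antisymm (fun t ht => ?_) fun t ht => ?_⟩
  · rw [EReal.lt_neg_comm, neg_zero]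
    simpa using hIlt 0 h0
  · obtain ⟨h1, h2⟩ := ht
    rw [neg_neg] at h1
    obtain ⟨_, ⟨a, ha, rfl⟩, hat⟩ := sInf_lt_iff.mp h1
    obtain ⟨_, ⟨b, hb, rfl⟩, htb⟩ := lt_sSup_iff.mp h2
    exact hA'.out ha hb ⟨(EReal.coe_lt_coe_iff.mp hat).le, (EReal.coe_lt_coe_iff.mp htb).le⟩
  · exact ⟨by rw [neg_neg]; exact hIlt t ht, hltS t ht⟩

/-- The union of all solutions on open intervals is a maximal solution. -/
theorem IsLocallyWellPosed.exists_isMaximalSolution {d : ℝ → ℝ} {N : H1 → L2} {φ : H1}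
    (h : IsLocallyWellPosed d N φ) :
    ∃ (S S' : EReal) (u : ℝ → H1), IsMaximalSolution d N φ S S' u ∧
      ∀ a b : ℝ, a < 0 → 0 < b → ∀ w, IsSolutionOn d N φ (Ioo a b) w →
        Ioo a b ⊆ lifespan S S' := by
  obtain ⟨⟨δ, hδ, u₀, hu₀⟩, huniq⟩ := h
  let A : Set ℝ := {t | ∃ a b : ℝ, a < 0 ∧ 0 < b ∧ t ∈ Ioo a b ∧
    ∃ w, IsSolutionOn d N φ (Ioo a b) w}
  have hIoo : ∀ a b : ℝ, a < 0 → 0 < b → ∀ w, IsSolutionOn d N φ (Ioo a b) w → Ioo a b ⊆ A :=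
    fun a b ha hb w hw t ht => ⟨a, b, ha, hb, ht, w, hw⟩
  have h0A : (0 : ℝ) ∈ A := hIoo (-δ) δ (by linarith) hδ u₀ hu₀ ⟨by linarith, hδ⟩
  have hAopen : IsOpen A := by
    rw [isOpen_iff_mem_nhds]
    rintro t ⟨a, b, ha, hb, ht, w, hw⟩
    exact mem_of_superset (Ioo_mem_nhds ht.1 ht.2) (hIoo a b ha hb w hw)
  have hAuIcc : ∀ t ∈ A, uIcc 0 t ⊆ A := by
    rintro t ⟨a, b, ha, hb, ht, w, hw⟩
    exact (ordConnected_Ioo.uIcc_subset ⟨ha, hb⟩ ht).trans (hIoo a b ha hb w hw)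
  have hAconn : A.OrdConnected := by
    refine ⟨fun x hx y hy z hz => ?_⟩
    rcases le_total 0 z with hz0 | hz0
    · exact hAuIcc y hy (by rw [uIcc_of_le (hz0.trans hz.2)]; exact ⟨hz0, hz.2⟩)
    · exact hAuIcc x hx (by rw [uIcc_of_ge (hz.1.trans hz0)]; exact ⟨hz.1, hz0⟩)
  have hch : ∀ t : ℝ, ∃ x : H1, ∀ a b : ℝ, a < 0 → 0 < b → t ∈ Ioo a b →
      ∀ w, IsSolutionOn d N φ (Ioo a b) w → w t = x := by
    intro t
    by_cases ht : t ∈ A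
    · obtain ⟨a, b, ha, hb, ht', w, hw⟩ := ht
      refine ⟨w t, fun a' b' ha' hb' ht'' w' hw' => ?_⟩
      refine huniq (Ioo a b ∩ Ioo a' b') (ordConnected_Ioo.inter ordConnected_Ioo)
        ⟨⟨ha, hb⟩, ⟨ha', hb'⟩⟩ w' w (hw'.mono inter_subset_right) (hw.mono inter_subset_left)
        ⟨ht', ht''⟩
    · exact ⟨0, fun a b ha hb ht' w hw => absurd (hIoo a b ha hb w hw ht') ht⟩
  -- `u t` is the common value at `t` of all solutions on open intervals containing `0` and `t`.
  choose u hu using hch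
  have husol : IsSolutionOn d N φ A u := by
    constructor
    · intro t ht
      obtain ⟨a, b, ha, hb, ht', w, hw⟩ := ht
      have hev : u =ᶠ[𝓝 t] w := by
        filter_upwards [Ioo_mem_nhds ht'.1 ht'.2] with s hs
        exact (hu s a b ha hb hs w hw).symm
      exact ((hw.1.continuousAt (Ioo_mem_nhds ht'.1 ht'.2)).congr hev.symm).continuousWithinAt
    · intro t ht
      obtain ⟨a, b, ha, hb, ht', w, hw⟩ := ht
      rw [← hu t a b ha hb ht' w hw, hw.2 t ht']
      congr 2
      refine intervalIntegral.integral_congr fun s hs => ?_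
      have hs' := ordConnected_Ioo.uIcc_subset ⟨ha, hb⟩ ht' hs
      simp only [hu s a b ha hb hs' w hw]
  obtain ⟨S, S', hS, hS', hSA⟩ := exists_eq_lifespan hAopen hAconn h0A
  refine ⟨S, S', u, ⟨hS, hS', hSA ▸ husol, fun R R' w hSR hSR' hw _ => ?_⟩, fun a b ha hb w hw => ?_⟩
  · have hR := hS.trans_le hSR
    have hR' := hS'.trans_le hSR'
    have hsub : lifespan R R' ⊆ lifespan S S' := by
      intro t ht
      obtain ⟨a, b, ha, hb, ht', hab⟩ := exists_Ioo_subset_lifespan hR hR' ht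
      rw [hSA]
      exact hIoo a b ha hb w (hw.mono hab) ht'
    have := le_of_lifespan_subset hR hR' hS hS' hsub
    exact ⟨le_antisymm this.1 hSR, le_antisymm this.2 hSR'⟩
  · rw [hSA]
    exact hIoo a b ha hb w hw

theorem IsLocallyWellPosed.hasUniqueMaximalSolution {d : ℝ → ℝ} {N : H1 → L2} {φ : H1}
    (h : IsLocallyWellPosed d N φ) : HasUniqueMaximalSolution d N φ := by
  obtain ⟨S, S', u, hu, hmax⟩ := h.exists_isMaximalSolution
  refine ⟨S, S', u, hu, fun R R' w hw => ?_⟩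
  obtain ⟨hR, hR', hwsol, hwmax⟩ := hw
  have hsub : lifespan R R' ⊆ lifespan S S' := by
    intro t ht
    obtain ⟨a, b, ha, hb, ht', hab⟩ := exists_Ioo_subset_lifespan hR hR' ht
    exact hmax a b ha hb w (hwsol.mono hab) ht'
  obtain ⟨hRS, hRS'⟩ := le_of_lifespan_subset hR hR' hu.1 hu.2.1 hsub
  have heq : EqOn u w (lifespan R R') := h.2 _ (ordConnected_lifespan R R')
    (zero_mem_lifespan hR hR') u w (hu.2.2.1.mono hsub) hwsol
  obtain ⟨e, e'⟩ := hwmax S S' u hRS hRS' hu.2.2.1 heq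
  subst e e'
  exact ⟨rfl, rfl, heq.symm⟩

/-- A maximal solution extends every solution on an open interval containing the initial time. -/
theorem IsMaximalSolution.extends_solution {d : ℝ → ℝ} {N : H1 → L2} {φ : H1} {R R' : EReal} {w : ℝ → H1}
    (hw : IsMaximalSolution d N φ R R' w) (h : IsLocallyWellPosed d N φ) {a b : ℝ} (ha : a < 0)
    (hb : 0 < b) {y : ℝ → H1} (hy : IsSolutionOn d N φ (Ioo a b) y) :
    Ioo a b ⊆ lifespan R R' ∧ EqOn w y (Ioo a b) := by
  obtain ⟨S, S', u, hu, hmax⟩ := h.exists_isMaximalSolution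
  obtain ⟨S₀, S₀', u₀, -, huniq⟩ := h.hasUniqueMaximalSolution
  obtain ⟨e1, e1', -⟩ := huniq S S' u hu
  obtain ⟨e2, e2', -⟩ := huniq R R' w hw
  have hsub : Ioo a b ⊆ lifespan R R' := by
    rw [e2, e2', ← e1, ← e1']
    exact hmax a b ha hb y hy
  exact ⟨hsub, h.2 _ ordConnected_Ioo ⟨ha, hb⟩ w y (hw.2.2.1.mono hsub) hy⟩

/-! ### The averaged nonlinearity -/

/-- The average `∫₀¹ T_r⁻¹ N(T_r f) dr` of a nonlinearity on `H¹(ℝ)`. -/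
def averaged (N : H1 → H1) (f : H1) : H1 := ∫ r in (0 : ℝ)..1, T₁ (-r) (N (T₁ r f))

theorem continuous_conj {N : H1 → H1} (hN : Continuous N) (f : H1) :
    Continuous fun r => T₁ (-r) (N (T₁ r f)) :=
  continuous_neg.T₁ (hN.comp (continuous_T₁ f))

theorem averaged_zero {N : H1 → H1} (h0 : N 0 = 0) : averaged N 0 = 0 := by
  simp [averaged, T₁_map_zero, h0]

theorem LipschitzOnBalls.averaged {N : H1 → H1} (hN : LipschitzOnBalls N) :
    LipschitzOnBalls (averaged N) := by
  intro R
  obtain ⟨L, hL0, hL⟩ := hN R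
  refine ⟨L, hL0, fun f g hf hg => ?_⟩
  have hi := fun h : H1 => (continuous_conj hN.continuous h).intervalIntegrable
    (μ := volume) 0 1
  unfold DMNLS.averaged
  rw [← intervalIntegral.integral_sub (hi f) (hi g)]
  have := intervalIntegral.norm_integral_le_of_norm_le_const (a := (0 : ℝ)) (b := 1)
    (f := fun r => T₁ (-r) (N (T₁ r f)) - T₁ (-r) (N (T₁ r g))) (C := L * ‖f - g‖) fun r _ => by
      rw [← T₁_sub_apply, norm_T₁, ← norm_T₁ r (f - g), T₁_sub_apply]
      exact hL _ _ (by rwa [norm_T₁]) (by rwa [norm_T₁])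
  simpa using this

theorem toL2_averaged_powerH1 {α : ℝ} (hα : 2 ≤ α) (f : H1) :
    (averaged (powerH1 α hα) f).toL2 = averagedNL α (zero_le_two.trans hα) f := by
  have hi := (continuous_conj (lipschitzOnBalls_powerH1 hα).continuous f).intervalIntegrable
    (μ := volume) 0 1
  have h := (H1.toL2CLM.intervalIntegral_comp_comm hi).symm
  refine Eq.trans h (intervalIntegral.integral_congr fun r _ => ?_)
  change T (-r) _ = (T r).symm _
  rw [T_symm_apply, toL2_powerH1]

/-- Conjugation by the group turns the average over `r` into an average of time translates. -/
theorem conjField_averaged {N : H1 → H1} (hN : Continuous N) (s : ℝ) (f : H1) :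
    conjField (averaged N) s f = ∫ r in (0 : ℝ)..1, conjField N (s + r) f := by
  have hi := (continuous_conj hN (T₁ s f)).intervalIntegrable (μ := volume) 0 1
  have h := ((Complex.I • T₁CLM (-s)).intervalIntegral_comp_comm hi).symm
  refine Eq.trans h (intervalIntegral.integral_congr fun r _ => ?_)
  change Complex.I • T₁ (-s) (T₁ (-r) (N (T₁ r (T₁ s f)))) = _
  rw [conjField, neg_add, T₁_add, add_comm s r, T₁_add]

/-! ### The dispersion map -/

theorem measurable_d₀ : Measurable d₀ := by
  refine Measurable.ite ?_ measurable_const measurable_const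
  exact measurableSet_lt (measurable_fract.comp (measurable_id.div_const 2)) measurable_const

theorem norm_d₀ (t : ℝ) : ‖d₀ t‖ = 1 := by
  unfold d₀
  split_ifs <;> simp

theorem intervalIntegrable_d₀_div (ε a b : ℝ) :
    IntervalIntegrable (fun s => d₀ (s / ε)) volume a b := by
  rw [intervalIntegrable_iff]
  refine Measure.integrableOn_of_bounded (M := 1) (by simp) ?_ ?_
  · exact (measurable_d₀.comp (measurable_id.div_const ε)).aestronglyMeasurable
  · exact Eventually.of_forall fun s => (norm_d₀ _).le

theorem intervalIntegrable_d₀ (a b : ℝ) : IntervalIntegrable d₀ volume a b := by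
  simpa using intervalIntegrable_d₀_div 1 a b

theorem intervalIntegrable_dispersion (dav ε a b : ℝ) :
    IntervalIntegrable (dispersion dav ε) volume a b :=
  intervalIntegrable_const.add ((intervalIntegrable_d₀_div ε a b).const_mul _)

theorem integral_dispersion (dav ε t : ℝ) (hε : 0 < ε) :
    ∫ r in (0 : ℝ)..t, dispersion dav ε r = dav * t + D (t / ε) := by
  unfold dispersion
  rw [intervalIntegral.integral_add intervalIntegrable_const
    ((intervalIntegrable_d₀_div ε 0 t).const_mul _), intervalIntegral.integral_const,
    intervalIntegral.integral_const_mul, intervalIntegral.integral_comp_div _ hε.ne', D]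
  simp only [sub_zero, smul_eq_mul, zero_div]
  field_simp

theorem continuous_D : Continuous D :=
  intervalIntegral.continuous_primitive intervalIntegrable_d₀ 0

theorem D_of_mem_Icc {t : ℝ} (ht : t ∈ Icc 0 1) : D t = t := by
  -- The open interval avoids the jump of `d₀` at the right endpoint `t = 1`.
  have h : ∫ s in (0 : ℝ)..t, d₀ s = ∫ s in (0 : ℝ)..t, (1 : ℝ) := by
    rw [intervalIntegral.integral_of_le ht.1, intervalIntegral.integral_of_le ht.1,
      integral_Ioc_eq_integral_Ioo, integral_Ioc_eq_integral_Ioo]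
    refine setIntegral_congr_fun measurableSet_Ioo fun s hs => ?_
    have hs1 : s < 1 := hs.2.trans_le ht.2
    have : Int.fract (s / 2) = s / 2 := Int.fract_eq_self.mpr ⟨by linarith [hs.1], by linarith⟩
    simp only [d₀, this]
    rw [if_pos (by linarith)]
  rw [D, h]
  simp

theorem D_of_mem_Icc_one_two {t : ℝ} (ht : t ∈ Icc 1 2) : D t = 2 - t := by
  have h : ∫ s in (1 : ℝ)..t, d₀ s = ∫ s in (1 : ℝ)..t, (-1 : ℝ) := by
    rw [intervalIntegral.integral_of_le ht.1, intervalIntegral.integral_of_le ht.1,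
      integral_Ioc_eq_integral_Ioo, integral_Ioc_eq_integral_Ioo]
    refine setIntegral_congr_fun measurableSet_Ioo fun s hs => ?_
    have hs1 : s < 2 := hs.2.trans_le ht.2
    have : Int.fract (s / 2) = s / 2 := Int.fract_eq_self.mpr ⟨by linarith [hs.1], by linarith⟩
    simp only [d₀, this]
    rw [if_neg (by linarith [hs.1])]
  have h1 : D t = D 1 + ∫ s in (1 : ℝ)..t, d₀ s :=
    (intervalIntegral.integral_add_adjacent_intervals (intervalIntegrable_d₀ _ _)
      (intervalIntegrable_d₀ _ _)).symm
  rw [h1, D_of_mem_Icc (by norm_num), h, intervalIntegral.integral_const, smul_eq_mul]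
  ring

theorem d₀_periodic : Function.Periodic d₀ 2 := by
  intro t
  have : (t + 2) / 2 = t / 2 + 1 := by ring
  simp only [d₀, this, Int.fract_add_one]

theorem D_periodic : Function.Periodic D 2 := by
  intro t
  have h0 : ∫ s in (0 : ℝ)..2, d₀ s = 0 := by
    have := D_of_mem_Icc_one_two (t := 2) (by norm_num)
    rwa [sub_self] at this
  have h1 : D (t + 2) = D t + ∫ s in t..(t + 2), d₀ s :=
    (intervalIntegral.integral_add_adjacent_intervals (intervalIntegrable_d₀ _ _)
      (intervalIntegrable_d₀ _ _)).symm
  have h2 := d₀_periodic.intervalIntegral_add_eq t 0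
  rw [zero_add, h0] at h2
  rw [h1, h2, add_zero]

/-- `D` rises from `0` to `1` and falls back at unit speed, so that averages over a period of `D`
are averages over `[0, 1]`. -/
theorem periodMean_comp_D {E : Type*} [NormedAddCommGroup E] [NormedSpace ℝ E] {h : ℝ → E}
    (hh : Continuous h) (s : ℝ) :
    periodMean 2 (fun _ τ => h (D τ)) s = ∫ r in (0 : ℝ)..1, h r := by
  have hi : ∀ a b, IntervalIntegrable (fun τ => h (D τ)) volume a b := fun a b =>
    (hh.comp continuous_D).intervalIntegrable a b
  have h1 : ∫ τ in (0 : ℝ)..1, h (D τ) = ∫ r in (0 : ℝ)..1, h r := by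
    refine intervalIntegral.integral_congr fun τ hτ => ?_
    rw [uIcc_of_le zero_le_one] at hτ
    simp only [D_of_mem_Icc hτ]
  have h2 : ∫ τ in (1 : ℝ)..2, h (D τ) = ∫ r in (0 : ℝ)..1, h r := by
    have : ∫ τ in (1 : ℝ)..2, h (D τ) = ∫ τ in (1 : ℝ)..2, h (2 - τ) := by
      refine intervalIntegral.integral_congr fun τ hτ => ?_
      rw [uIcc_of_le one_le_two] at hτ
      simp only [D_of_mem_Icc_one_two hτ]
    rw [this, intervalIntegral.integral_comp_sub_left]
    norm_num
  rw [periodMean, ← intervalIntegral.integral_add_adjacent_intervals (hi 0 1) (hi 1 2), h1, h2,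
    ← two_smul ℝ, inv_smul_smul₀ two_ne_zero]

/-! ### Convergence of the dispersion managed equation -/

/-- The vector field of the dispersion managed equation, with the fast time `τ = t / ε` made an
independent variable, averages to that of the averaged equation. -/
theorem periodMean_conjField {N : H1 → H1} (hN : Continuous N) (dav s : ℝ) (f : H1) :
    periodMean 2 (fun s τ => conjField N (dav * s + D τ) f) s =
      conjField (averaged N) (dav * s) f := by
  have h1 : Continuous fun r : ℝ => conjField N (dav * s + r) f := by
    have h2 : Continuous fun r : ℝ => (dav * s + r, f) := by fun_prop
    have h3 := (continuous_conjField hN).comp h2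
    exact h3
  have h3 := periodMean_comp_D h1 s
  simp only [periodMean] at h3 ⊢
  rw [conjField_averaged hN, ← h3]

theorem isLocallyWellPosed_averaged (dav : ℝ) {α : ℝ} (hα : 2 ≤ α) (φ : H1) :
    IsLocallyWellPosed (fun _ => dav) (averagedNL α (zero_le_two.trans hα)) φ :=
  isLocallyWellPosed_of_lipschitz (θ := fun t => dav * t) φ (fun _ _ => intervalIntegrable_const)
    (fun t => by simp [mul_comm]) (toL2_averaged_powerH1 hα)
    (lipschitzOnBalls_powerH1 hα).averaged (averaged_zero (powerH1_zero hα))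

theorem isLocallyWellPosed_dispersion (dav : ℝ) {ε : ℝ} (hε : 0 < ε) {α : ℝ} (hα : 2 ≤ α) (φ : H1) :
    IsLocallyWellPosed (dispersion dav ε) (powerNL α (zero_le_two.trans hα)) φ :=
  isLocallyWellPosed_of_lipschitz φ (intervalIntegrable_dispersion dav ε)
    (fun t => integral_dispersion dav ε t hε) (toL2_powerH1 hα) (lipschitzOnBalls_powerH1 hα)
    (powerH1_zero hα)

/-- The quantitative form of the convergence, with a pointwise bound on `[-M, M]`. -/
theorem eventually_near_averaged (dav : ℝ) {α : ℝ} (hα : 2 ≤ α) {φ : H1} {v : ℝ → H1}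
    {Tm Tp : EReal} {u : ℝ → ℝ → H1} {Sm Sp : ℝ → EReal}
    (hv : IsMaximalSolution (fun _ => dav) (averagedNL α (zero_le_two.trans hα)) φ Tm Tp v)
    (hu : ∀ ε : ℝ, 0 < ε → IsMaximalSolution (dispersion dav ε)
      (powerNL α (zero_le_two.trans hα)) φ (Sm ε) (Sp ε) (u ε))
    {M : ℝ} (hM : 0 < M) (hMT : (M : EReal) < min Tm Tp) {η : ℝ} (hη : 0 < η) :
    ∀ᶠ ε in 𝓝[>] (0 : ℝ), Icc (-M) M ⊆ lifespan (Sm ε) (Sp ε) ∧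
      ∀ t ∈ Icc (-M) M, ‖u ε t - T₁ (D (t / ε)) (v t)‖ ≤ η := by
  -- Maximality concerns open intervals, so the argument is run on `(-M', M')` with `M' > M`.
  obtain ⟨M', hMM', hM'T⟩ := EReal.lt_iff_exists_real_btwn.mp hMT
  rw [EReal.coe_lt_coe_iff] at hMM'
  have hM'0 : 0 < M' := hM.trans hMM'
  have hsub : Icc (-M') M' ⊆ lifespan Tm Tp := by
    intro t ht
    have h1 : (M' : EReal) < Tm := hM'T.trans_le (min_le_left _ _)
    have h2 : (M' : EReal) < Tp := hM'T.trans_le (min_le_right _ _)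
    refine ⟨?_, (EReal.coe_le_coe_iff.mpr ht.2).trans_lt h2⟩
    refine (EReal.neg_lt_neg_iff.mpr h1).trans_le ?_
    rw [← EReal.coe_neg]
    exact EReal.coe_le_coe_iff.mpr ht.1
  set N := powerH1 α hα with hN
  have hNlip : LipschitzOnBalls N := lipschitzOnBalls_powerH1 hα
  have h0M' : (0 : ℝ) ∈ Icc (-M') M' := ⟨by linarith, hM'0.le⟩
  have hz : IsIntegralSolution (fun t => conjField (averaged N) (dav * t)) φ (Icc (-M') M')
      fun t => T₁ (-(dav * t)) (v t) :=
    (isSolutionOn_iff (θ := fun t => dav * t) (fun _ _ => intervalIntegrable_const)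
      (fun t => by simp [mul_comm]) (toL2_averaged_powerH1 hα) hNlip.averaged.continuous
      ordConnected_Icc h0M').mp (hv.2.2.1.mono hsub)
  have hG : Continuous fun p : ℝ × ℝ × H1 => conjField N (dav * p.1 + D p.2.1) p.2.2 := by
    have h1 : Continuous fun p : ℝ × ℝ × H1 => (dav * p.1 + D p.2.1, p.2.2) :=
      ((continuous_const.mul continuous_fst).add
        (continuous_D.comp (continuous_fst.comp continuous_snd))).prodMk
        (continuous_snd.comp continuous_snd)
    have h2 := (continuous_conjField hNlip.continuous).comp h1
    exact h2
  have hmean : (fun s x => periodMean 2 (fun s τ => conjField N (dav * s + D τ) x) s) =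
      fun t => conjField (averaged N) (dav * t) := by
    funext s x
    exact periodMean_conjField hNlip.continuous dav s x
  have key := exists_solution_near_averaged (G := fun s τ x => conjField N (dav * s + D τ) x)
    (x₀ := φ) (M := M') (z := fun t => T₁ (-(dav * t)) (v t)) hG two_pos
    (fun s x τ => by simp only [D_periodic τ])
    (fun s τ => conjField_zero (powerH1_zero hα) _)
    (fun R => by
      obtain ⟨L, hL0, hL⟩ := hNlip.conjField R
      exact ⟨L, hL0, fun s τ => hL _⟩)
    hM'0.le (by rw [hmean]; exact hz) hη
  filter_upwards [key, self_mem_nhdsWithin] with ε ⟨y, hy, hyz⟩ hε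
  have hε0 : 0 < ε := hε
  have hIoo : IsSolutionOn (dispersion dav ε) (powerNL α (zero_le_two.trans hα)) φ (Ioo (-M') M')
      fun t => T₁ (dav * t + D (t / ε)) (y t) := by
    rw [isSolutionOn_iff (θ := fun t => dav * t + D (t / ε)) (intervalIntegrable_dispersion dav ε)
      (fun t => integral_dispersion dav ε t hε0) (toL2_powerH1 hα) hNlip.continuous
      ordConnected_Ioo ⟨by linarith, hM'0⟩]
    simpa only [T₁_neg_apply] using hy.mono Ioo_subset_Icc_self
  obtain ⟨hlife, heq⟩ := (hu ε hε0).extends_solution (isLocallyWellPosed_dispersion dav hε0 hα φ)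
    (by linarith) hM'0 hIoo
  have hMI : Icc (-M) M ⊆ Ioo (-M') M' := fun t ht =>
    ⟨by linarith [ht.1], by linarith [ht.2]⟩
  refine ⟨hMI.trans hlife, fun t ht => ?_⟩
  have e : T₁ (D (t / ε)) (v t) = T₁ (dav * t + D (t / ε)) (T₁ (-(dav * t)) (v t)) := by
    rw [← T₁_add]
    congr 1
    ring
  rw [heq (hMI ht), e]
  change ‖T₁ (dav * t + D (t / ε)) (y t) - _‖ ≤ η
  rw [← T₁_sub_apply, norm_T₁]
  exact hyz t (Ioo_subset_Icc_self (hMI ht))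

end DMNLS

end

open DMNLS in
theorem corollary1p2 (dav α : ℝ) (hα : 2 ≤ α) (φ : H1) :
    HasUniqueMaximalSolution (fun _ => dav) (averagedNL α (zero_le_two.trans hα)) φ ∧
    (∀ ε : ℝ, 0 < ε →
      HasUniqueMaximalSolution (dispersion dav ε) (powerNL α (zero_le_two.trans hα)) φ) ∧
    ∀ (v : ℝ → H1) (Tm Tp : EReal) (u : ℝ → ℝ → H1) (Sm Sp : ℝ → EReal),
      IsMaximalSolution (fun _ => dav) (averagedNL α (zero_le_two.trans hα)) φ Tm Tp v →
      (∀ ε : ℝ, 0 < ε → IsMaximalSolution (dispersion dav ε)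
        (powerNL α (zero_le_two.trans hα)) φ (Sm ε) (Sp ε) (u ε)) →
      ∀ M : ℝ, 0 < M → (M : EReal) < min Tm Tp →
        (∀ᶠ ε in 𝓝[>] (0 : ℝ), Set.Icc (-M) M ⊆ lifespan (Sm ε) (Sp ε)) ∧
        Tendsto
          (fun ε : ℝ => eLpNorm (fun t : ℝ => u ε t - T₁ (D (t / ε)) (v t)) ∞
            (volume.restrict (Set.Icc (-M) M)))
          (𝓝[>] (0 : ℝ)) (𝓝 0) := by
  refine ⟨(isLocallyWellPosed_averaged dav hα φ).hasUniqueMaximalSolution,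
    fun ε hε => (isLocallyWellPosed_dispersion dav hε hα φ).hasUniqueMaximalSolution,
    fun v Tm Tp u Sm Sp hv hu M hM hMT => ⟨?_, ?_⟩⟩
  · exact (eventually_near_averaged dav hα hv hu hM hMT one_pos).mono fun ε h => h.1
  · refine ENNReal.tendsto_nhds_zero.mpr fun η hη => ?_
    obtain ⟨r, hr0, hrη⟩ := ENNReal.lt_iff_exists_nnreal_btwn.mp hη
    have hr : (0 : ℝ) < r := NNReal.coe_pos.mpr (ENNReal.coe_pos.mp hr0)
    filter_upwards [eventually_near_averaged dav hα hv hu hM hMT hr] with ε h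
    rw [eLpNorm_exponent_top]
    refine (eLpNormEssSup_le_of_ae_bound (C := r) ?_).trans ?_
    · exact (ae_restrict_mem measurableSet_Icc).mono h.2
    · rw [ENNReal.ofReal_coe_nnreal]
      exact hrη.le
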